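/- **Setting.** Let $S$ be a complete separable metric space with a locally finite Borel reference measure ($\mathrm{d}u$ denotes integration with respect to it and to its powers); all sets and functions below are Borel/measurable. Let $X$ be a (simple, boundedly finite) point process in $S$, i.e. a random element of the space $\mathcal X$ of subsets of $S$ with finitely many points in every bounded set, with the $\sigma$-algebra generated by the counts. Let $\breve X\subseteq S\times\{0,1\}$ be an arbitrary bivariate marking of $X$ (each point of $X$ carries exactly one mark, possibly random and dependent on everything else), $Z=\{x:(x,1)\in\breve X\}$ the corresponding thinning and $Y=X\setminus Z$. For $\mathbf z\in\mathcal X$ let $\mathbf z^n_{\neq}$ be the set of $n$-tuples of pairwise distinct points of $\mathbf z$. Fix $n\ge 1$. For $\xi,h:S^n\times\mathcal X\to\mathbb R$ and $A\subseteq S^n$ the bivariate innovation is $$\mathcal I_\xi^h(A;\mathbf z,\mathbf y)=\sum_{x\in \mathbf z_{\neq}^n\cap A}h(x;\mathbf y\setminus\{x_1,\dots,x_n\})-\int_A h(u;\mathbf y)\xi(u;\mathbf y)\,\mathrm du ,$$ and $\mathcal I_\xi^h(A;\mathbf y)=\mathcal I_\xi^h(A;\mathbf y,\mathbf y)$. A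 function $\rho_Z^{(k)}:S^k\to[0,\infty)$ is a $k$th-order product density of $Z$ if $\mathbb E\sum_{x\in Z^k_{\neq}}f(x)=\int_{S^k} f\rho_Z^{(k)}\,\mathrm du$ for all $f\ge0$. A function $\breve\lambda^{(k)}\ge0$ on $(S\times\{0,1\})^k\times\breve{\mathcal X}$, where $\breve{\mathcal X}$ is the space of configurations in $S\times\{0,1\}$, is a $k$th-order Papangelou conditional intensity of $\breve X$ if $\mathbb E\sum_{x\in\breve X^k_{\neq}}f(x;\breve X\setminus\{x_1,\dots,x_k\})=\int\mathbb E[f(u;\breve X)\breve\lambda^{(k)}(u;\breve X)]\,\mathrm du$ for all $f\ge 0$, the reference measure on $\{0,1\}$ being counting measure. Write $\breve\lambda_1^{(k)}(u;\breve X)=\breve\lambda^{(k)}((u_1,1),\dots,(u_k,1);\breve X)$. For $0\le j\le n$ and $u\in S^{2n-j}$ put $u'=(u_1,\dots,u_n)$ and $u''=(u_1,\dots,u_j,u_{n+1},\dots,u_{2n-j})$. For a function $f$ on $S^n$ put $\bar f(u)=\frac1{n!}\sum_{\sigma}f(u_{\sigma(1)},\dots,u_{\sigma(n)})$, so that $\bar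 f=f$ if $f$ is permutation invariant. **(1) $\xi,h:S^n\to\mathbb R$ do not depend on the configuration.** Then $\mathcal I_\xi^h(A;Z,Y)=\mathcal I_\xi^h(A;Z)$. Assume that $\rho_Z^{(n)}$ exists. (a) If $\int_A|h|\rho_Z^{(n)}<\infty$ and $\int_A|h\xi|<\infty$, then $\mathcal I_\xi^h(A;Z)$ is integrable and $$\mathbb E[\mathcal I_\xi^h(A;Z)]=\int_A h(u)\bigl(\rho_Z^{(n)}(u)-\xi(u)\bigr)\,\mathrm du .$$ (b) If $\rho_Z^{(k)}$ exists for $n\le k\le 2n$, $\mathbb E[(\sum_{x\in Z^n_{\neq}\cap A}|h(x)|)^2]<\infty$ and $\int_A|h\xi|<\infty$, then $\mathcal I_\xi^h(A;Z)$ is square integrable and, with $f=\mathbf 1_Ah$, $$\operatorname{Var}(\mathcal I_\xi^h(A;Z))=\sum_{j=0}^n j!\binom nj^2\int_{S^{2n-j}}\bar f(u')\bar f(u'')\rho_Z^{(2n-j)}(u)\,\mathrm du-\Bigl(\int_Ah\rho_Z^{(n)}\,\mathrm du\Bigr)^2 ;$$ in particular, if $\mathbf 1_Ah$ is permutation invariant,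 $\bar f(u')\bar f(u'')$ may be replaced by $\mathbf 1\{u'\in A\}\mathbf 1\{u''\in A\}h(u')h(u'')$. (c) The expectation in (a) is $0$ for all $A$ and $h$ satisfying the condition in (a) if and only if $\xi=\rho_Z^{(n)}$ a.e. on $S^n$. **(2) $\xi,h:S^n\times\mathcal X\to\mathbb R$.** Assume that $\breve\lambda^{(n)}$ exists. (a) If $\int_A\mathbb E[|h(u;Y)|\breve\lambda_1^{(n)}(u;\breve X)]\,\mathrm du<\infty$ and $\int_A\mathbb E|h(u;Y)\xi(u;Y)|\,\mathrm du<\infty$, then $\mathcal I_\xi^h(A;Z,Y)$ is integrable and $$\mathbb E[\mathcal I_\xi^h(A;Z,Y)]=\int_A\mathbb E\bigl[h(u;Y)\bigl(\breve\lambda_1^{(n)}(u;\breve X)-\xi(u;Y)\bigr)\bigr]\,\mathrm du .$$ (b) If $\breve\lambda^{(k)}$ exists for $n\le k\le 2n$, $\mathbb E[(\sum_{x\in Z^n_{\neq}\cap A}|h(x;Y\setminus\{x_1,\dots,x_n\})|)^2]<\infty$ and $\mathbb E[(\int_A|h(u;Y)\xi(u;Y)|\,\mathrm du)^2]<\infty$,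 then $\mathcal I_\xi^h(A;Z,Y)$ is square integrable and, with $f_Y(u)=\mathbf 1_A(u)h(u;Y)$, $$\begin{aligned}\mathbb E[\mathcal I_\xi^h(A;Z,Y)^2]=&\sum_{j=0}^n j!\binom nj^2\int_{S^{2n-j}}\mathbb E\bigl[\bar f_Y(u')\bar f_Y(u'')\breve\lambda_1^{(2n-j)}(u;\breve X)\bigr]\,\mathrm du\\&+\int_A\int_A\mathbb E[h(u;Y)h(v;Y)\xi(u;Y)\xi(v;Y)]\,\mathrm dv\,\mathrm du\\&-2\int_A\int_A\mathbb E[h(u;Y)h(v;Y)\xi(v;Y)\breve\lambda_1^{(n)}(u;\breve X)]\,\mathrm dv\,\mathrm du ;\end{aligned}$$ in particular, if $\mathbf 1_Ah(\cdot;\mathbf y)$ is permutation invariant for every $\mathbf y$, $\bar f_Y(u')\bar f_Y(u'')$ may be replaced by $\mathbf 1\{u',u''\in A\}h(u';Y)h(u'';Y)$. (c) Assume that $\mathbb E[\breve\lambda_1^{(n)}(u;\breve X)^2]<\infty$ for almost every $u\in S^n$. Then $\mathbb E[\mathcal I_\xi^h(A;Z,Y)]=0$ for all $A$ and all $h$ that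 satisfy the conditions in (a) and $\mathbb E[h(u;Y)^2]<\infty$ for almost every $u$, if and only if, for almost every $u\in S^n$, $$\xi(u;Y)=\mathbb E\bigl[\breve\lambda_1^{(n)}(u;\breve X)\,\big|\,Y\bigr]\quad\text{a.s.}$$ -/

import Mathlib

open MeasureTheory ProbabilityTheory
open scoped NNReal ENNReal

/-- The two-point mark space `{0, 1}` is bounded (`true` is the mark 1, `false` the mark 0). -/
instance instBornologyBool : Bornology Bool := Bornology.cofinite

/-- Point configurations: subsets with finitely many points in every bounded set. -/
def Config (T : Type*) [Bornology T] : Type _ :=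
  {x : Set T // ∀ B : Set T, Bornology.IsBounded B → (x ∩ B).Finite}

namespace Config

variable {T : Type*} [Bornology T]

/-- The set of points of a configuration. -/
def pts (x : Config T) : Set T := x.1

/-- The σ-algebra generated by the counts `x ↦ #(x ∩ A)`, for measurable `A`. -/
instance [MeasurableSpace T] : MeasurableSpace (Config T) :=
  MeasurableSpace.generateFrom
    {E | ∃ A : Set T, MeasurableSet A ∧ ∃ k : ℕ∞, E = {x : Config T | (x.pts ∩ A).encard = k}}

/-- The configuration `x \ s`. -/
def remove (x : Config T) (s : Set T) : Config T :=
  ⟨x.pts \ s, fun B hB => (x.2 B hB).subset (Set.inter_subset_inter_left B Set.sdiff_subset)⟩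

/-- The set `x_≠^n` of `n`-tuples of pairwise distinct points of `x`. -/
def tuples (n : ℕ) (x : Config T) : Set (Fin n → T) :=
  {u | (∀ i, u i ∈ x.pts) ∧ Function.Injective u}

/-- The points of a marked configuration that carry the mark 1. -/
def retained {S : Type*} [Bornology S] (x : Config (S × Bool)) : Config S :=
  ⟨{s | (s, true) ∈ x.pts}, fun B hB => by
    have hb : Bornology.IsBounded (B ×ˢ (Set.univ : Set Bool)) :=
      hB.prod (by
        rw [Bornology.isBounded_def]
        change (Set.univ : Set Bool)ᶜ ∈ Filter.cofinite
        simp)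
    refine ((x.2 _ hb).image Prod.fst).subset ?_
    rintro s ⟨hs, hsB⟩
    exact ⟨(s, true), ⟨hs, hsB, Set.mem_univ _⟩, rfl⟩⟩

end Config

/-- `Xb` is a bivariate marking of `X`: a marked point process with ground process `X` in which
every point of `X` carries exactly one (arbitrary, possibly random) mark. -/
structure IsBivariateMarking {S Ω : Type*} [Bornology S] [MeasurableSpace S] [MeasurableSpace Ω]
    (X : Ω → Config S) (Xb : Ω → Config (S × Bool)) : Prop where
  measurable_ground : Measurable X
  measurable_marked : Measurable Xb
  ground : ∀ ω, Prod.fst '' (Xb ω).pts = (X ω).pts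
  unique_mark : ∀ ω, Set.InjOn Prod.fst (Xb ω).pts

/-- The product reference measure on `T^k`. -/
noncomputable abbrev refMeasure {T : Type*} [MeasurableSpace T] (ν : Measure T) (k : ℕ) :
    Measure (Fin k → T) :=
  Measure.pi fun _ => ν

/-- `ρ` is a `k`-th order product density of the point process `Z` (Campbell formula). -/
def IsProductDensity {T Ω : Type*} [Bornology T] [MeasurableSpace T] [MeasurableSpace Ω]
    (ν : Measure T) (P : Measure Ω) (Z : Ω → Config T) (k : ℕ) (ρ : (Fin k → T) → ℝ≥0) : Prop :=
  Measurable ρ ∧ ∀ f : (Fin k → T) → ℝ≥0∞, Measurable f →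
    ∫⁻ ω, ∑' x : (Z ω).tuples k, f x ∂P = ∫⁻ u, f u * ρ u ∂(refMeasure ν k)

/-- `lam` is a `k`-th order Papangelou conditional intensity of the point process `X`
(Georgii-Nguyen-Zessin formula). -/
def IsPapangelou {T Ω : Type*} [Bornology T] [MeasurableSpace T] [MeasurableSpace Ω]
    (ν : Measure T) (P : Measure Ω) (X : Ω → Config T) (k : ℕ)
    (lam : (Fin k → T) → Config T → ℝ≥0) : Prop :=
  Measurable (Function.uncurry lam) ∧
  ∀ f : (Fin k → T) → Config T → ℝ≥0∞, Measurable (Function.uncurry f) →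
    ∫⁻ ω, ∑' x : (X ω).tuples k, f x ((X ω).remove (Set.range x.1)) ∂P =
      ∫⁻ u, ∫⁻ ω, f u (X ω) * lam u (X ω) ∂P ∂(refMeasure ν k)

/-- The evaluation `lam ((u_1, 1), …, (u_k, 1); x)`. -/
def atMarkOne {S : Type*} [Bornology S] {k : ℕ}
    (lam : (Fin k → S × Bool) → Config (S × Bool) → ℝ≥0)
    (u : Fin k → S) (x : Config (S × Bool)) : ℝ :=
  lam (fun i => (u i, true)) x

/-- The bivariate innovation `I_ξ^h(A; z, y)`. -/
noncomputable def innovation {S : Type*} [Bornology S] [MeasurableSpace S] (μ : Measure S) {n : ℕ}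
    (ξ h : (Fin n → S) → Config S → ℝ) (A : Set (Fin n → S)) (z y : Config S) : ℝ :=
  ∑' x : ↥(z.tuples n ∩ A), h x (y.remove (Set.range x.1)) -
    ∫ u in A, h u y * ξ u y ∂(refMeasure μ n)

/-- The univariate innovation `I_ξ^h(A; y) = I_ξ^h(A; y, y)`. -/
noncomputable def univariateInnovation {S : Type*} [Bornology S] [MeasurableSpace S]
    (μ : Measure S) {n : ℕ} (ξ h : (Fin n → S) → Config S → ℝ) (A : Set (Fin n → S))
    (y : Config S) : ℝ :=
  innovation μ ξ h A y y

/-- The tuple `(u_1, …, u_n)` of `(u_1, …, u_{2n-j})`, for `0 ≤ j ≤ n`. -/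
def firstTuple {S : Type*} {n : ℕ} (j : Fin (n + 1)) (u : Fin (2 * n - j) → S) : Fin n → S :=
  fun i => u ⟨i, by omega⟩

/-- The tuple `(u_1, …, u_j, u_{n+1}, …, u_{2n-j})` of `(u_1, …, u_{2n-j})`, for `0 ≤ j ≤ n`. -/
def secondTuple {S : Type*} {n : ℕ} (j : Fin (n + 1)) (u : Fin (2 * n - j) → S) : Fin n → S :=
  fun i => if _ : (i : ℕ) < j then u ⟨i, by omega⟩ else u ⟨n + (i - j), by omega⟩

/-- `∑_{j=0}^n j! (n choose j)^2 ∫_{S^{2n-j}} F_j(u) du`. -/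
noncomputable def pairSum {S : Type*} [MeasurableSpace S] (μ : Measure S) (n : ℕ)
    (F : (j : Fin (n + 1)) → (Fin (2 * n - j) → S) → ℝ) : ℝ :=
  ∑ j : Fin (n + 1), ((j : ℕ).factorial : ℝ) * (n.choose j : ℝ) ^ 2 *
    ∫ u, F j u ∂(refMeasure μ (2 * n - j))

/-- Invariance under permutations of the `n` arguments. -/
def PermInvariant {S : Type*} {n : ℕ} (f : (Fin n → S) → ℝ) : Prop :=
  ∀ (σ : Equiv.Perm (Fin n)) (u : Fin n → S), f (u ∘ σ) = f u

/-- The symmetrization `u ↦ (1 / n!) ∑_σ f(u_{σ(1)}, …, u_{σ(n)})`; it is `f` itself if `f` is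
permutation invariant. -/
noncomputable def symmetrize {S : Type*} {n : ℕ} (f : (Fin n → S) → ℝ) (u : Fin n → S) : ℝ :=
  (n.factorial : ℝ)⁻¹ * ∑ σ : Equiv.Perm (Fin n), f (u ∘ σ)

/-!
The two settings are instances of one Campbell formula (`CampbellFormula`): for nonnegative `g`,
the expected sum of `g (x; Y)` over the `k`-tuples `x` of distinct points of `Z` is
`∫ E[g (u; Y) w (u)] du`. If `ξ` and `h` are deterministic, `Y` is constant and `w` is the product
density. Otherwise `Y` is the process of discarded points and `w` is the conditional intensity of
the marked process at the mark 1: the Georgii-Nguyen-Zessin formula is applied to functions that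
vanish unless all marks are 1, and removing retained points does not change `Y`
(`IsPapangelou.campbellFormula`). For the same reason the innovation is a sum of `h (x; Y)` minus a
function of `Y`, the compensator (`innovation_eq`).

* Expectation: the Campbell formula for real functions (`CampbellFormula.integral_tsum`). It needs
  the measurability of sums over the tuples of a random configuration, which holds because the
  counting measures of the points form an s-finite kernel (`Config.measurable_tsum_tuples`).
* Second moment: the square of a sum over `n`-tuples is a sum over pairs of `n`-tuples. Sorting the
  pairs by the matching of the positions at which they have a common point turns it into sums over
  `(2n - j)`-tuples, and there are `j! (n choose j)^2` matchings of size `j`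
  (`hasSum_pairs_of_tuples`). The two remaining terms come from the Campbell formula for the product
  of the summand with the compensator, and from Fubini's theorem
  (`CampbellFormula.integral_innovation_sq`).
* Vanishing expectations: the σ-algebra of the configurations is generated by a countable π-system
  (`Config.exists_countable_piSystem`). Testing with the indicators of its members, multiplied by a
  positive function of `(u, Y)` that makes all terms integrable, identifies `ξ (u; Y)` with the
  conditional expectation of `w (u)` given `Y`, for almost every `u` simultaneously for all members
  (`forall_integral_mul_sub_eq_zero_iff`).
-/

/-! ### Measurability of sums over the points of a configuration -/

namespace Config

/-- The counts `x ↦ #(x ∩ A)` are measurable: they generate the σ-algebra. -/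
theorem measurable_encard {T : Type*} [Bornology T] [MeasurableSpace T] {A : Set T}
    (hA : MeasurableSet A) : Measurable fun x : Config T => (x.pts ∩ A).encard :=
  measurable_to_countable' fun k => MeasurableSpace.measurableSet_generateFrom ⟨A, hA, k, rfl⟩

/-- A map into the configurations is measurable as soon as the counts along it are. -/
theorem measurable_of_encard {T E : Type*} [Bornology T] [MeasurableSpace T] [MeasurableSpace E]
    {z : E → Config T}
    (h : ∀ A : Set T, MeasurableSet A → Measurable fun e => ((z e).pts ∩ A).encard) :
    Measurable z := by
  refine measurable_generateFrom ?_
  rintro _ ⟨A, hA, k, rfl⟩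
  exact h A hA (measurableSet_singleton k)

universe u v

variable {S : Type u} [MetricSpace S] [MeasurableSpace S] [BorelSpace S]

/-- A metric space has a countable measurable partition into bounded sets. -/
theorem exists_measurable_nat_bounded_fibers (S : Type*) [MetricSpace S] [MeasurableSpace S]
    [BorelSpace S] :
    ∃ ι : S → ℕ, Measurable ι ∧ ∀ i, Bornology.IsBounded (ι ⁻¹' {i}) := by
  rcases isEmpty_or_nonempty S with hS | ⟨⟨o⟩⟩
  · exact ⟨fun _ => 0, measurable_const, fun i => by simp [Set.eq_empty_of_isEmpty]⟩
  · refine ⟨fun s => ⌊dist s o⌋₊, ?_, fun i => ?_⟩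
    · exact Nat.measurable_floor.comp (continuous_id.dist continuous_const).measurable
    · refine (Metric.isBounded_closedBall (x := o) (r := i + 1)).subset fun s hs => ?_
      have : ⌊dist s o⌋₊ = i := hs
      rw [Metric.mem_closedBall, ← this]
      exact (Nat.lt_floor_add_one _).le

/-- The counting measure of a set of points, as a sum of Dirac measures. -/
noncomputable def pointMeasure {T : Type*} [MeasurableSpace T] (s : Set T) : Measure T :=
  Measure.sum fun t : s => Measure.dirac (t : T)

theorem pointMeasure_apply {T : Type*} [MeasurableSpace T] (s : Set T) {A : Set T}
    (hA : MeasurableSet A) : pointMeasure s A = ((s ∩ A).encard : ℝ≥0∞) := by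
  rw [pointMeasure, Measure.sum_apply _ hA, ← ENNReal.tsum_set_one, tsum_subtype s
    (fun t => Measure.dirac t A), tsum_subtype (s ∩ A) (fun _ => (1 : ℝ≥0∞))]
  congr 1 with t
  by_cases h1 : t ∈ s <;> by_cases h2 : t ∈ A <;> simp [h1, h2, hA, Set.indicator]

theorem lintegral_pointMeasure {T : Type*} [MeasurableSpace T] (s : Set T) {g : T → ℝ≥0∞}
    (hg : Measurable g) : ∫⁻ t, g t ∂(pointMeasure s) = ∑' t : s, g t := by
  rw [pointMeasure, lintegral_sum_measure]
  exact tsum_congr fun t => lintegral_dirac' _ hg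

open Classical in
/-- The counting measure of the points in the `i`-th set of a bounded partition, on the event that
there are `m` of them. -/
noncomputable def cellKernel {ι : S → ℕ} (hι : Measurable ι) (p : ℕ × ℕ) :
    Kernel (Config S) S where
  toFun x := if (x.pts ∩ ι ⁻¹' {p.1}).encard = p.2 then pointMeasure (x.pts ∩ ι ⁻¹' {p.1}) else 0
  measurable' := by
    have hB : MeasurableSet (ι ⁻¹' {p.1}) := hι (measurableSet_singleton _)
    refine Measurable.ite (measurable_encard hB (measurableSet_singleton _)) ?_ measurable_const
    refine Measure.measurable_of_measurable_coe _ fun A hA => ?_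
    simp_rw [pointMeasure_apply _ hA, Set.inter_assoc]
    exact (Measurable.of_discrete (f := fun k : ℕ∞ => (k : ℝ≥0∞))).comp
      (measurable_encard (hB.inter hA))

instance {ι : S → ℕ} (hι : Measurable ι) (p : ℕ × ℕ) : IsFiniteKernel (cellKernel hι p) := by
  refine ⟨p.2, ENNReal.natCast_lt_top _, fun x => ?_⟩
  change (if _ then _ else _ : Measure S) _ ≤ _
  split_ifs with h
  · rw [pointMeasure_apply _ MeasurableSet.univ, Set.inter_univ, h]
    simp
  · simp

/-- Sums over the points of a random configuration are measurable: the counting measures of the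
points form an s-finite kernel. -/
theorem measurable_tsum_pts {E : Type*} [MeasurableSpace E] {z : E → Config S} (hz : Measurable z)
    {g : S → E → ℝ≥0∞} (hg : Measurable (Function.uncurry g)) :
    Measurable fun e => ∑' s : (z e).pts, g s e := by
  obtain ⟨ι, hι, hb⟩ := exists_measurable_nat_bounded_fibers S
  have key : (fun e => ∑' s : (z e).pts, g s e) = fun e =>
      ∫⁻ s, g s e ∂((Kernel.sum (cellKernel hι)).comap z hz e) := by
    ext e
    have hge : Measurable fun s => g s e := hg.comp measurable_prodMk_right
    rw [Kernel.comap_apply, Kernel.sum_apply, lintegral_sum_measure,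
      ENNReal.tsum_prod (f := fun i m => ∫⁻ s, g s e ∂(cellKernel hι (i, m) (z e)))]
    have h1 : ∀ i : ℕ, ∑' m : ℕ, ∫⁻ s, g s e ∂(cellKernel hι (i, m) (z e)) =
        ∑' s : ↥((z e).pts ∩ ι ⁻¹' {i}), g s e := by
      intro i
      have hfin : ((z e).pts ∩ ι ⁻¹' {i}).Finite := (z e).2 _ (hb i)
      rw [tsum_eq_single ((z e).pts ∩ ι ⁻¹' {i}).ncard, ← lintegral_pointMeasure _ hge]
      · congr 1
        exact if_pos hfin.cast_ncard_eq.symm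
      · intro m hm
        have h0 : cellKernel hι (i, m) (z e) = 0 := if_neg fun h => hm <| by
          have h' : ((z e).pts ∩ ι ⁻¹' {i}).encard = m := h
          rw [← hfin.cast_ncard_eq] at h'
          exact_mod_cast h'.symm
        simp [h0]
    simp_rw [h1, tsum_subtype _ (fun s => g s e)]
    rw [ENNReal.tsum_comm]
    refine tsum_congr fun s => ?_
    rw [tsum_eq_single (ι s)]
    · by_cases h : s ∈ (z e).pts <;> simp [Set.indicator, h]
    · intro i hi
      simp [Set.indicator, Ne.symm hi]
  rw [key]
  exact Measurable.lintegral_kernel_prod_right (hg.comp measurable_swap)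

/-- Sums over all tuples (with possible repetitions) of points are measurable. -/
theorem measurable_tsum_pi_pts {S : Type u} [MetricSpace S] [MeasurableSpace S] [BorelSpace S]
    (k : ℕ) {E : Type (max u v)} [MeasurableSpace E] {z : E → Config S}
    (hz : Measurable z) {g : (Fin k → S) → E → ℝ≥0∞} (hg : Measurable (Function.uncurry g)) :
    Measurable fun e => ∑' u : Fin k → (z e).pts, g (fun i => u i) e := by
  induction k generalizing E with
  | zero =>
    have : (fun e => ∑' u : Fin 0 → (z e).pts, g (fun i => u i) e) =
        fun e => g (fun i => i.elim0) e := by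
      ext e
      rw [tsum_eq_single (fun i => i.elim0) fun b hb => (hb (Subsingleton.elim _ _)).elim]
      congr 1
      exact Subsingleton.elim _ _
    rw [this]
    exact hg.comp measurable_prodMk_left
  | succ k ih =>
    have : (fun e => ∑' u : Fin (k + 1) → (z e).pts, g (fun i => u i) e) =
        fun e => ∑' s : (z e).pts, ∑' v : Fin k → (z e).pts,
          g (Fin.cons (s : S) fun i => (v i : S)) e := by
      ext e
      rw [← ENNReal.tsum_prod, ← (Fin.consEquiv fun _ => ↥(z e).pts).tsum_eq]
      refine tsum_congr fun p => ?_
      congr 1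
      ext i
      refine Fin.cases ?_ (fun i => ?_) i <;> simp [Fin.consEquiv]
    rw [this]
    refine measurable_tsum_pts hz
      (g := fun s e => ∑' v : Fin k → (z e).pts, g (Fin.cons s fun i => (v i : S)) e) ?_
    refine ih (E := S × E) (hz.comp measurable_snd) (g := fun v p => g (Fin.cons p.1 v) p.2) ?_
    refine hg.comp (Measurable.prodMk (measurable_pi_iff.2 fun i => ?_)
      (measurable_snd.comp measurable_snd))
    refine Fin.cases ?_ (fun i => ?_) i
    · exact measurable_fst.comp measurable_snd
    · exact (measurable_pi_apply i).comp measurable_fst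

theorem measurableSet_injective [SecondCountableTopology S] (k : ℕ) :
    MeasurableSet {u : Fin k → S | Function.Injective u} := by
  have : {u : Fin k → S | Function.Injective u} =
      ⋂ i : Fin k, ⋂ j : Fin k, ⋂ _ : i ≠ j, {u : Fin k → S | u i = u j}ᶜ := by
    ext u
    simp only [Set.mem_ofPred_eq, Set.mem_iInter, Set.mem_compl_iff]
    exact ⟨fun h i j hij hu => hij (h hu), fun h i j hu => by_contra fun hij => h i j hij hu⟩
  rw [this]
  exact MeasurableSet.iInter fun i => MeasurableSet.iInter fun j => MeasurableSet.iInter fun _ =>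
    (measurableSet_eq_fun (measurable_pi_apply i) (measurable_pi_apply j)).compl

/-- Sums over the tuples of pairwise distinct points of a random configuration are measurable. -/
theorem measurable_tsum_tuples [SecondCountableTopology S] (k : ℕ) {E : Type v}
    [MeasurableSpace E] {z : E → Config S} (hz : Measurable z) {g : (Fin k → S) → E → ℝ≥0∞}
    (hg : Measurable (Function.uncurry g)) :
    Measurable fun e => ∑' u : (z e).tuples k, g u e := by
  have : (fun e => ∑' u : (z e).tuples k, g u e) = fun e => ∑' u : Fin k → (z e).pts,
      {u : Fin k → S | Function.Injective u}.indicator (fun u => g u e) (fun i => u i) := by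
    ext e
    let F : (z e).tuples k → Fin k → (z e).pts := fun u i => ⟨u.1 i, u.2.1 i⟩
    have hF : Function.Injective F := fun u v h => Subtype.ext <| funext fun i =>
      congrArg Subtype.val (congrFun h i)
    rw [← hF.tsum_eq]
    · exact tsum_congr fun u => by simp [F, Set.indicator, u.2.2]
    · intro u hu
      have hinj : Function.Injective fun i => (u i : S) := by
        by_contra h
        exact hu (Set.indicator_of_notMem (by simpa using h) _)
      exact ⟨⟨fun i => u i, fun i => (u i).2, hinj⟩, rfl⟩
  rw [this]
  -- the universe lift brings the parameter into the universe of the induction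
  refine (measurable_tsum_pi_pts.{u, v} k (E := ULift.{u} E) (hz.comp measurable_down)
    (g := fun u e => {u : Fin k → S | Function.Injective u}.indicator (fun u => g u e.down) u)
    ?_).comp measurable_up
  refine Measurable.comp (g := Function.uncurry fun u e =>
    {u : Fin k → S | Function.Injective u}.indicator (fun u => g u e) u) ?_
    (measurable_fst.prodMk (measurable_down.comp measurable_snd))
  have := hg.indicator ((measurableSet_injective (S := S) k).preimage
    (measurable_fst (β := E)))
  convert this using 1
  ext ⟨u, e⟩
  simp [Set.indicator]

/-- The σ-algebra on configurations is generated by a countable π-system. -/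
theorem exists_countable_piSystem [SecondCountableTopology S] :
    ∃ C : Set (Set (Config S)), C.Countable ∧ IsPiSystem C ∧
      (inferInstance : MeasurableSpace (Config S)) = MeasurableSpace.generateFrom C := by
  obtain ⟨ι, hι, hb⟩ := exists_measurable_nat_bounded_fibers S
  obtain ⟨b, hbc, hbS⟩ := MeasurableSpace.CountablyGenerated.isCountablyGenerated (α := S)
  -- a countable π-system that generates the Borel sets and contains the whole space
  set D := generateSetAlgebra b with hD
  have hDc : D.Countable := countable_generateSetAlgebra hbc
  have hDpi : IsPiSystem D := isSetAlgebra_generateSetAlgebra.isSetRing.isSetSemiring.isPiSystem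
  have hDgen : (inferInstance : MeasurableSpace S) = MeasurableSpace.generateFrom D := by
    rw [hD, generateFrom_generateSetAlgebra_eq, ← hbS]
  have hDm : ∀ A ∈ D, MeasurableSet A := fun A hA => by
    have := MeasurableSpace.measurableSet_generateFrom hA
    rwa [← hDgen] at this
  let C₀ : Set (Set (Config S)) :=
    (fun q : Set S × ℕ × ℕ∞ => {x : Config S | (x.pts ∩ (ι ⁻¹' {q.2.1} ∩ q.1)).encard = q.2.2}) ''
      (D ×ˢ Set.univ)
  have hC₀ : C₀.Countable := (hDc.prod Set.countable_univ).image _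
  refine ⟨generateSetAlgebra C₀, countable_generateSetAlgebra hC₀,
    isSetAlgebra_generateSetAlgebra.isSetRing.isSetSemiring.isPiSystem, ?_⟩
  rw [generateFrom_generateSetAlgebra_eq]
  refine le_antisymm ?_ (MeasurableSpace.generateFrom_le ?_)
  · let m₀ : MeasurableSpace (Config S) := MeasurableSpace.generateFrom C₀
    have hcell : ∀ i : ℕ, Measurable[m₀] fun x : Config S => pointMeasure (x.pts ∩ ι ⁻¹' {i}) := by
      intro i
      have hB : MeasurableSet (ι ⁻¹' {i}) := hι (measurableSet_singleton _)
      have hfin : ∀ x : Config S, IsFiniteMeasure (pointMeasure (x.pts ∩ ι ⁻¹' {i})) := by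
        intro x
        refine ⟨?_⟩
        rw [pointMeasure_apply _ MeasurableSet.univ, Set.inter_univ]
        exact ENat.toENNReal_lt_top.2 (Set.encard_lt_top_iff.2 (x.2 _ (hb i)))
      have hm : ∀ A ∈ D, Measurable[m₀] fun x : Config S =>
          pointMeasure (x.pts ∩ ι ⁻¹' {i}) A := by
        intro A hA
        simp_rw [pointMeasure_apply _ (hDm A hA), Set.inter_assoc]
        refine (Measurable.of_discrete (f := fun k : ℕ∞ => (k : ℝ≥0∞))).comp
          (measurable_to_countable' fun k => ?_)
        exact MeasurableSpace.measurableSet_generateFrom ⟨(A, i, k), ⟨hA, trivial⟩, rfl⟩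
      exact Measurable.measure_of_isPiSystem hDgen hDpi hm
        (hm _ isSetAlgebra_generateSetAlgebra.univ_mem)
    refine MeasurableSpace.generateFrom_le ?_
    rintro _ ⟨A, hA, k, rfl⟩
    have hsum : (fun x : Config S => ((x.pts ∩ A).encard : ℝ≥0∞)) =
        fun x => ∑' i : ℕ, pointMeasure (x.pts ∩ ι ⁻¹' {i}) A := by
      ext x
      simp_rw [pointMeasure_apply _ hA, ← ENNReal.tsum_set_one,
        tsum_subtype _ (fun _ => (1 : ℝ≥0∞))]
      rw [ENNReal.tsum_comm]
      refine tsum_congr fun s => ?_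
      rw [tsum_eq_single (ι s)]
      · by_cases h : s ∈ x.pts <;> by_cases h' : s ∈ A <;> simp [Set.indicator, h, h']
      · intro i hi
        simp [Set.indicator, Ne.symm hi]
    have hmeas : Measurable[m₀] fun x : Config S => ((x.pts ∩ A).encard : ℝ≥0∞) := by
      rw [hsum]
      exact Measurable.tsum fun i => (Measure.measurable_coe hA).comp (hcell i)
    have := hmeas (measurableSet_singleton ((k : ℕ∞) : ℝ≥0∞))
    convert this using 1
    ext x
    simp
  · rintro _ ⟨⟨A, i, k⟩, ⟨hA, -⟩, rfl⟩
    exact measurable_encard ((hι (measurableSet_singleton i)).inter (hDm A hA))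
      (measurableSet_singleton k)

/-! ### The two components of a marked configuration -/

section Marks

variable {T : Type*}

/-- The points of a marked configuration that carry the mark 0. -/
def unretained [Bornology T] (x : Config (T × Bool)) : Config T :=
  ⟨{s | (s, false) ∈ x.pts}, fun B hB => by
    have hb : Bornology.IsBounded (B ×ˢ (Set.univ : Set Bool)) :=
      hB.prod (by
        rw [Bornology.isBounded_def]
        change (Set.univ : Set Bool)ᶜ ∈ Filter.cofinite
        simp)
    refine ((x.2 _ hb).image Prod.fst).subset ?_
    rintro s ⟨hs, hsB⟩
    exact ⟨(s, false), ⟨hs, hsB, Set.mem_univ _⟩, rfl⟩⟩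

theorem encard_section_inter (x : Set (T × Bool)) (b : Bool) (A : Set T) :
    ({s | (s, b) ∈ x} ∩ A).encard = (x ∩ A ×ˢ {b}).encard := by
  have hinj : Function.Injective fun s : T => (s, b) := fun s t h => (Prod.ext_iff.1 h).1
  rw [← hinj.encard_image]
  congr 1
  ext ⟨s, c⟩
  constructor
  · rintro ⟨t, ⟨ht, htA⟩, h⟩
    obtain ⟨rfl, rfl⟩ := Prod.ext_iff.1 h
    exact ⟨ht, htA, rfl⟩
  · rintro ⟨hx, hA, hc⟩
    obtain rfl : c = b := hc
    exact ⟨s, ⟨hx, hA⟩, rfl⟩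

theorem measurable_retained [Bornology T] [MeasurableSpace T] :
    Measurable (retained : Config (T × Bool) → Config T) := by
  refine measurable_of_encard fun A hA => ?_
  have : (fun x : Config (T × Bool) => (x.retained.pts ∩ A).encard) =
      fun x => (x.pts ∩ A ×ˢ {true}).encard := funext fun x => encard_section_inter _ _ _
  rw [this]
  exact measurable_encard (hA.prod (measurableSet_singleton _))

theorem measurable_unretained [Bornology T] [MeasurableSpace T] :
    Measurable (unretained : Config (T × Bool) → Config T) := by
  refine measurable_of_encard fun A hA => ?_
  have : (fun x : Config (T × Bool) => (x.unretained.pts ∩ A).encard) =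
      fun x => (x.pts ∩ A ×ˢ {false}).encard := funext fun x => encard_section_inter _ _ _
  rw [this]
  exact measurable_encard (hA.prod (measurableSet_singleton _))

end Marks

end Config

/-- Since the marks are unique, the points of `X` outside the retained ones are exactly the points
with mark 0. -/
theorem IsBivariateMarking.remove_retained_eq {S Ω : Type*} [Bornology S] [MeasurableSpace S]
    [MeasurableSpace Ω] {X : Ω → Config S} {Xb : Ω → Config (S × Bool)}
    (h : IsBivariateMarking X Xb) (ω : Ω) :
    (X ω).remove (Xb ω).retained.pts = (Xb ω).unretained := by
  refine Subtype.ext ?_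
  ext s
  change s ∈ (X ω).pts \ {s | (s, true) ∈ (Xb ω).pts} ↔ (s, false) ∈ (Xb ω).pts
  rw [← h.ground ω]
  constructor
  · rintro ⟨⟨⟨t, b⟩, ht, rfl⟩, hs⟩
    cases b
    · exact ht
    · exact (hs ht).elim
  · intro hs
    refine ⟨⟨_, hs, rfl⟩, fun ht => ?_⟩
    have := h.unique_mark ω hs ht rfl
    simp at this

/-! ### Pairs of tuples sorted by their common points -/

section Overlap

variable {T : Type*} {n : ℕ}

theorem firstTuple_injective {j : Fin (n + 1)} {u : Fin (2 * n - j) → T}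
    (hu : Function.Injective u) : Function.Injective (firstTuple j u) := by
  intro a b h
  simpa [Fin.ext_iff] using hu h

/-- The position in `(u_1, …, u_{2n-j})` of the `i`-th entry of the second tuple. -/
theorem exists_secondTuple_eq (j : Fin (n + 1)) (i : Fin n) :
    ∃ k : Fin (2 * n - j), (k : ℕ) = (if (i : ℕ) < j then (i : ℕ) else n + (i - j)) ∧
      ∀ u : Fin (2 * n - j) → T, secondTuple j u i = u k := by
  by_cases h : (i : ℕ) < j
  · exact ⟨⟨i, by omega⟩, by simp [h], fun u => by simp [secondTuple, h]⟩
  · exact ⟨⟨n + (i - j), by omega⟩, by simp [h], fun u => by simp [secondTuple, h]⟩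

theorem secondTuple_injective {j : Fin (n + 1)} {u : Fin (2 * n - j) → T}
    (hu : Function.Injective u) : Function.Injective (secondTuple j u) := by
  intro a b h
  obtain ⟨k, hk, hku⟩ := exists_secondTuple_eq (T := T) j a
  obtain ⟨l, hl, hlu⟩ := exists_secondTuple_eq (T := T) j b
  rw [hku, hlu] at h
  have hkl : (k : ℕ) = l := congrArg _ (hu h)
  ext
  split_ifs at hk hl <;> omega

theorem firstTuple_eq_secondTuple_iff {j : Fin (n + 1)} {u : Fin (2 * n - j) → T}
    (hu : Function.Injective u) (a b : Fin n) :
    firstTuple j u a = secondTuple j u b ↔ a = b ∧ (a : ℕ) < j := by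
  obtain ⟨l, hl, hlu⟩ := exists_secondTuple_eq (T := T) j b
  rw [hlu, firstTuple, hu.eq_iff, Fin.ext_iff, Fin.ext_iff]
  simp only
  split_ifs at hl <;> omega

theorem eq_of_firstTuple_eq_of_secondTuple_eq {j : Fin (n + 1)} {u v : Fin (2 * n - j) → T}
    (h1 : firstTuple j u = firstTuple j v) (h2 : secondTuple j u = secondTuple j v) : u = v := by
  ext k
  by_cases hk : (k : ℕ) < n
  · exact congrFun h1 ⟨k, hk⟩
  · have := congrFun h2 ⟨k - n + j, by omega⟩
    obtain ⟨l, hl, hlu⟩ := exists_secondTuple_eq (T := T) j ⟨k - n + j, by omega⟩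
    rw [hlu, hlu] at this
    have hlk : l = k := by
      ext
      simp only at hl
      split_ifs at hl <;> omega
    rwa [hlk] at this

/-- Two tuples of distinct entries that agree exactly in their first `j` places come from a tuple
of `2n - j` distinct entries. -/
theorem exists_firstTuple_eq_secondTuple_eq (j : Fin (n + 1)) {x y : Fin n → T}
    (hx : Function.Injective x) (hy : Function.Injective y)
    (hxy : ∀ a b, x a = y b ↔ a = b ∧ (a : ℕ) < j) :
    ∃ u : Fin (2 * n - j) → T, Function.Injective u ∧ firstTuple j u = x ∧ secondTuple j u = y ∧
      ∀ k, u k ∈ Set.range x ∪ Set.range y := by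
  let u : Fin (2 * n - j) → T := fun k =>
    if hk : (k : ℕ) < n then x ⟨k, hk⟩ else y ⟨k - n + j, by omega⟩
  have h1 : firstTuple j u = x := by
    ext i
    simp [firstTuple, u]
  have h2 : secondTuple j u = y := by
    ext i
    obtain ⟨l, hl, hlu⟩ := exists_secondTuple_eq (T := T) j i
    rw [hlu]
    by_cases hi : (i : ℕ) < j
    · rw [if_pos hi] at hl
      have : (l : ℕ) < n := by omega
      simp only [u, this, dif_pos]
      rw [hxy]
      exact ⟨Fin.ext hl, by simp only; omega⟩
    · rw [if_neg hi] at hl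
      have : ¬ (l : ℕ) < n := by omega
      simp only [u, this, dif_neg, not_false_eq_true]
      congr 1
      ext
      simp only
      omega
  refine ⟨u, fun k l hkl => ?_, h1, h2, fun k => ?_⟩
  · simp only [u] at hkl
    ext
    split_ifs at hkl with hk hl hl
    · simpa using hx hkl
    · have := (hxy _ _).1 hkl
      simp only [Fin.ext_iff] at this
      omega
    · have := (hxy _ _).1 hkl.symm
      simp only [Fin.ext_iff] at this
      omega
    · have := hy hkl
      simp only [Fin.ext_iff] at this
      omega
  · simp only [u]
    split_ifs
    · exact Or.inl ⟨_, rfl⟩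
    · exact Or.inr ⟨_, rfl⟩

theorem exists_perm_extending {j : ℕ} (hj : j ≤ n) (f : Fin j ↪ Fin n) :
    ∃ σ : Equiv.Perm (Fin n), ∀ k : Fin j, σ (Fin.castLE hj k) = f k := by
  have := Equiv.Perm.isMultiplyPretransitive (Fin n) j
  obtain ⟨σ, hσ⟩ := MulAction.exists_smul_eq (Equiv.Perm (Fin n)) (Fin.castLEEmb hj) f
  exact ⟨σ, fun k => by rw [← hσ]; rfl⟩

variable [Bornology T]

/-- The pairs of tuples of points of `z` whose coincidences `x_i = y_k` are given by the partial
matching `m` between the positions. -/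
def matchedPairs (z : Config T) (m : Σ a : Finset (Fin n), (a ↪ Fin n)) :
    Set (z.tuples n × z.tuples n) :=
  {p | ∀ i k, p.1.1 i = p.2.1 k ↔ ∃ h : i ∈ m.1, m.2 ⟨i, h⟩ = k}

theorem pairwise_disjoint_matchedPairs (z : Config T) :
    Pairwise (Function.onFun Disjoint (matchedPairs (n := n) z)) := by
  rintro ⟨a, e⟩ ⟨b, f⟩ hne
  rw [Function.onFun, Set.disjoint_left]
  intro p hp hq
  refine hne ?_
  obtain rfl : a = b := by
    ext i
    constructor
    · intro h
      obtain ⟨h', -⟩ := (hq i (e ⟨i, h⟩)).1 ((hp i _).2 ⟨h, rfl⟩)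
      exact h'
    · intro h
      obtain ⟨h', -⟩ := (hp i (f ⟨i, h⟩)).1 ((hq i _).2 ⟨h, rfl⟩)
      exact h'
  congr 1
  ext ⟨i, h⟩
  obtain ⟨_, h'⟩ := (hq i (e ⟨i, h⟩)).1 ((hp i _).2 ⟨h, rfl⟩)
  exact congrArg Fin.val h'.symm

theorem iUnion_matchedPairs (z : Config T) :
    ⋃ m, matchedPairs (n := n) z m = Set.univ := by
  classical
  refine Set.eq_univ_of_forall fun p => ?_
  let a : Finset (Fin n) := {i | ∃ k, p.1.1 i = p.2.1 k}
  have ha : ∀ i : a, ∃ k, p.1.1 i = p.2.1 k := fun i =>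
    (Finset.mem_filter.1 i.2).2
  choose e he using ha
  refine Set.mem_iUnion.2 ⟨⟨a, e, fun i i' h => ?_⟩, fun i k => ⟨fun h => ?_, ?_⟩⟩
  · exact Subtype.ext (p.1.2.2 (by rw [he, he, h]))
  · have hi : i ∈ a := by simpa [a] using ⟨k, h⟩
    exact ⟨hi, p.2.2.2 ((he ⟨i, hi⟩).symm.trans h)⟩
  · rintro ⟨h, rfl⟩
    exact he ⟨i, h⟩

/-- The number of matched positions. -/
def matchingSize (m : Σ a : Finset (Fin n), (a ↪ Fin n)) : Fin (n + 1) :=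
  ⟨m.1.card, Nat.lt_succ_of_le (by simpa using m.1.card_le_univ)⟩

/-- After a permutation of the positions in both tuples, a matching of size `j` pairs the first
`j` places, so that the matched pairs correspond to tuples of `2n - j` distinct points. -/
theorem hasSum_matchedPairs {M : Type*} [AddCommMonoid M] [TopologicalSpace M] (z : Config T)
    (m : Σ a : Finset (Fin n), (a ↪ Fin n)) {G : (Fin n → T) → (Fin n → T) → M}
    (hG : ∀ (σ τ : Equiv.Perm (Fin n)) x y, G (x ∘ σ) (y ∘ τ) = G x y) {t : M}
    (ht : HasSum (fun u : z.tuples (2 * n - matchingSize m) =>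
      G (firstTuple (matchingSize m) u) (secondTuple (matchingSize m) u)) t) :
    HasSum (fun p : matchedPairs z m => G p.1.1 p.1.2) t := by
  classical
  set j := matchingSize m
  have hjn : (j : ℕ) ≤ n := Nat.le_of_lt_succ j.2
  let f : Fin j ↪ Fin n := (m.1.equivFin.symm : Fin m.1.card ≃ m.1).toEmbedding.trans
    (Function.Embedding.subtype _)
  have hfm : ∀ k, f k ∈ m.1 := fun k => (m.1.equivFin.symm k).2
  have hf : ∀ i ∈ m.1, ∃ k, f k = i := fun i hi => ⟨m.1.equivFin ⟨i, hi⟩,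
    congrArg Subtype.val (m.1.equivFin.symm_apply_apply ⟨i, hi⟩)⟩
  let g : Fin j ↪ Fin n := (m.1.equivFin.symm : Fin m.1.card ≃ m.1).toEmbedding.trans m.2
  have hg : ∀ k, g k = m.2 ⟨f k, hfm k⟩ := fun k => rfl
  obtain ⟨σ, hσ⟩ := exists_perm_extending hjn f
  obtain ⟨τ, hτ⟩ := exists_perm_extending hjn g
  have key : ∀ a b : Fin n, (a = b ∧ (a : ℕ) < j) ↔ ∃ h : σ a ∈ m.1, m.2 ⟨σ a, h⟩ = τ b := by
    intro a b
    constructor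
    · rintro ⟨rfl, ha⟩
      have h1 := hσ ⟨a, ha⟩
      have h2 := hτ ⟨a, ha⟩
      simp only [Fin.castLE_mk, Fin.eta] at h1 h2
      refine ⟨h1 ▸ hfm _, ?_⟩
      rw [h2, hg]
      congr 2
    · rintro ⟨h, hab⟩
      obtain ⟨k, hk⟩ := hf _ h
      have hak : a = Fin.castLE hjn k := σ.injective (by rw [hσ, hk])
      have hbk : b = Fin.castLE hjn k := τ.injective (by
        rw [hτ, hg, ← hab]
        congr 2
        exact hk.symm)
      exact ⟨hak.trans hbk.symm, by rw [hak]; exact k.2⟩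
  have hmem : ∀ (u : Fin (2 * n - j) → T), (∀ k, u k ∈ z.pts) →
      ∀ i, firstTuple j u i ∈ z.pts ∧ secondTuple j u i ∈ z.pts := by
    intro u hu i
    obtain ⟨k, -, hk⟩ := exists_secondTuple_eq (T := T) j i
    exact ⟨hu _, by rw [hk]; exact hu _⟩
  let F : z.tuples (2 * n - j) → matchedPairs z m := fun u =>
    ⟨(⟨firstTuple j u ∘ σ.symm, fun i => (hmem u u.2.1 _).1,
        (firstTuple_injective u.2.2).comp σ.symm.injective⟩,
      ⟨secondTuple j u ∘ τ.symm, fun i => (hmem u u.2.1 _).2,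
        (secondTuple_injective u.2.2).comp τ.symm.injective⟩), fun i k => by
      change firstTuple j u.1 (σ.symm i) = secondTuple j u.1 (τ.symm k) ↔ _
      rw [firstTuple_eq_secondTuple_iff u.2.2, key]
      simp⟩
  have hF : Function.Bijective F := by
    constructor
    · intro u v huv
      have h := congrArg Subtype.val huv
      have h1 : firstTuple j u.1 ∘ σ.symm = firstTuple j v.1 ∘ σ.symm :=
        congrArg Subtype.val (congrArg Prod.fst h)
      have h2 : secondTuple j u.1 ∘ τ.symm = secondTuple j v.1 ∘ τ.symm :=
        congrArg Subtype.val (congrArg Prod.snd h)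
      exact Subtype.ext (eq_of_firstTuple_eq_of_secondTuple_eq
        (σ.symm.surjective.injective_comp_right h1) (τ.symm.surjective.injective_comp_right h2))
    · rintro ⟨⟨⟨x, hxz, hx⟩, ⟨y, hyz, hy⟩⟩, hp⟩
      obtain ⟨u, hu, h1, h2, h3⟩ := exists_firstTuple_eq_secondTuple_eq j
        (hx.comp σ.injective) (hy.comp τ.injective) fun a b => by
          rw [key]
          exact hp (σ a) (τ b)
      refine ⟨⟨u, fun k => ?_, hu⟩, ?_⟩
      · rcases h3 k with ⟨i, hi⟩ | ⟨i, hi⟩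
        · exact hi ▸ hxz _
        · exact hi ▸ hyz _
      · refine Subtype.ext (Prod.ext (Subtype.ext ?_) (Subtype.ext ?_))
        · change firstTuple j u ∘ σ.symm = x
          rw [h1]
          ext i
          simp
        · change secondTuple j u ∘ τ.symm = y
          rw [h2]
          ext i
          simp
  rw [← (Equiv.ofBijective F hF).hasSum_iff]
  convert ht using 1
  ext u
  exact hG σ.symm τ.symm (firstTuple j u.1) (secondTuple j u.1)

/-- A sum over pairs of tuples of distinct points, for a function that is symmetric in each of the
tuples, is a sum over tuples of `2n - j` distinct points, `0 ≤ j ≤ n`. The number of matchings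
of `j` positions of the one tuple with `j` positions of the other is `j! (n choose j)^2`. -/
theorem hasSum_pairs_of_tuples {M : Type*} [AddCommMonoid M] [TopologicalSpace M] [ContinuousAdd M]
    (z : Config T) {G : (Fin n → T) → (Fin n → T) → M}
    (hG : ∀ (σ τ : Equiv.Perm (Fin n)) x y, G (x ∘ σ) (y ∘ τ) = G x y) {t : Fin (n + 1) → M}
    (ht : ∀ j : Fin (n + 1), HasSum (fun u : z.tuples (2 * n - j) =>
      G (firstTuple j u) (secondTuple j u)) (t j)) :
    HasSum (fun p : z.tuples n × z.tuples n => G p.1 p.2)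
      (∑ j : Fin (n + 1), ((j : ℕ).factorial * n.choose j ^ 2) • t j) := by
  classical
  have h1 := hasSum_sum_disjoint (f := fun p : z.tuples n × z.tuples n => G p.1 p.2)
    Finset.univ (t := matchedPairs z) (a := fun m => t (matchingSize m))
    (fun _ _ _ _ h => pairwise_disjoint_matchedPairs z h)
    fun m _ => hasSum_matchedPairs z m hG (ht _)
  have h2 : (⋃ m ∈ (Finset.univ : Finset (Σ a : Finset (Fin n), (a ↪ Fin n))),
      matchedPairs z m) = Set.univ := by
    simpa using iUnion_matchedPairs z
  rw [h2, hasSum_subtype_iff_indicator, Set.indicator_univ] at h1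
  convert h1 using 1
  -- a function of the size of the matched set of positions, to be summed over all subsets
  let t' : ℕ → M := fun k => if hk : k < n + 1 then t ⟨k, hk⟩ else 0
  have ht' : ∀ m : Σ a : Finset (Fin n), (a ↪ Fin n), t (matchingSize m) = t' m.1.card := by
    intro m
    have := (matchingSize m).2
    simp only [matchingSize] at this
    simp only [t', this, dif_pos]
    rfl
  simp_rw [ht']
  rw [Fintype.sum_sigma]
  simp only [Finset.sum_const, Finset.card_univ, Fintype.card_embedding_eq, Fintype.card_fin,
    Fintype.card_coe]
  rw [← Finset.powerset_univ, Finset.sum_powerset_apply_card (fun k => n.descFactorial k • t' k),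
    Finset.card_univ, Fintype.card_fin, Finset.sum_range]
  refine Finset.sum_congr rfl fun j _ => ?_
  rw [smul_smul, Nat.descFactorial_eq_factorial_mul_choose]
  simp only [t', j.2, dif_pos, Fin.eta]
  congr 1
  ring

end Overlap

/-! ### Symmetrization -/

section Symmetrize

variable {T : Type*} {n : ℕ}

theorem symmetrize_permInvariant (f : (Fin n → T) → ℝ) : PermInvariant (symmetrize f) := by
  intro σ u
  unfold symmetrize
  congr 1
  exact Equiv.sum_comp (Equiv.mulLeft σ) fun τ => f (u ∘ τ)

theorem PermInvariant.symmetrize_eq {f : (Fin n → T) → ℝ} (hf : PermInvariant f) :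
    symmetrize f = f := by
  ext u
  have hn : (n.factorial : ℝ) ≠ 0 := by exact_mod_cast n.factorial_ne_zero
  simp [symmetrize, hf _ u, Fintype.card_perm, hn]

theorem enorm_symmetrize_le (f : (Fin n → T) → ℝ) (u : Fin n → T) :
    ‖symmetrize f u‖ₑ ≤ (n.factorial : ℝ≥0∞)⁻¹ * ∑ σ : Equiv.Perm (Fin n), ‖f (u ∘ σ)‖ₑ := by
  unfold symmetrize
  rw [enorm_mul]
  have : ‖(n.factorial : ℝ)⁻¹‖ₑ = (n.factorial : ℝ≥0∞)⁻¹ := by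
    rw [enorm_inv (by exact_mod_cast n.factorial_ne_zero)]
    simp
  rw [this]
  gcongr
  exact enorm_sum_le _ _

variable [Bornology T]

/-- Permutations of the positions act on the tuples of distinct points. -/
def tuplesPerm (z : Config T) (σ : Equiv.Perm (Fin n)) : z.tuples n ≃ z.tuples n where
  toFun u := ⟨u.1 ∘ σ, fun i => u.2.1 _, u.2.2.comp σ.injective⟩
  invFun u := ⟨u.1 ∘ σ.symm, fun i => u.2.1 _, u.2.2.comp σ.symm.injective⟩
  left_inv u := Subtype.ext (by ext i; simp)
  right_inv u := Subtype.ext (by ext i; simp)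

theorem tsum_enorm_symmetrize_le (z : Config T) (f : (Fin n → T) → ℝ) :
    ∑' u : z.tuples n, ‖symmetrize f u‖ₑ ≤ ∑' u : z.tuples n, ‖f u‖ₑ := by
  refine (ENNReal.tsum_le_tsum (g := fun u : z.tuples n =>
    (n.factorial : ℝ≥0∞)⁻¹ * ∑ σ : Equiv.Perm (Fin n), ‖f (u ∘ σ)‖ₑ)
    fun u => enorm_symmetrize_le f u).trans ?_
  rw [ENNReal.tsum_mul_left, Summable.tsum_finsetSum fun _ _ => ENNReal.summable]
  have : ∀ σ : Equiv.Perm (Fin n), ∑' u : z.tuples n, ‖f (u ∘ σ)‖ₑ = ∑' u : z.tuples n, ‖f u‖ₑ :=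
    fun σ => (tuplesPerm z σ).tsum_eq fun u : z.tuples n => ‖f u‖ₑ
  simp only [this, Finset.sum_const, Finset.card_univ, Fintype.card_perm, Fintype.card_fin,
    nsmul_eq_mul]
  rw [← mul_assoc, ENNReal.inv_mul_cancel (by exact_mod_cast n.factorial_ne_zero)
    (ENNReal.natCast_ne_top _), one_mul]

theorem hasSum_symmetrize {z : Config T} {f : (Fin n → T) → ℝ} {a : ℝ}
    (hf : HasSum (fun u : z.tuples n => f u) a) :
    HasSum (fun u : z.tuples n => symmetrize f u) a := by
  have h1 : ∀ σ : Equiv.Perm (Fin n), HasSum (fun u : z.tuples n => f (u ∘ σ)) a :=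
    fun σ => (tuplesPerm z σ).hasSum_iff.2 hf
  have h2 := (hasSum_sum fun σ (_ : σ ∈ Finset.univ) => h1 σ).mul_left (n.factorial : ℝ)⁻¹
  have hn : (n.factorial : ℝ) ≠ 0 := by exact_mod_cast n.factorial_ne_zero
  simpa [Fintype.card_perm, hn, symmetrize] using h2

/-- The square of the absolute sum over `n`-tuples dominates each of its parts, sorted by the
number of common points. -/
theorem tsum_enorm_symmetrize_pair_le (z : Config T) (f : (Fin n → T) → ℝ) (j : Fin (n + 1)) :
    ∑' u : z.tuples (2 * n - j),
      ‖symmetrize f (firstTuple j u) * symmetrize f (secondTuple j u)‖ₑ ≤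
        (∑' u : z.tuples n, ‖f u‖ₑ) ^ 2 := by
  let F : z.tuples (2 * n - j) → z.tuples n × z.tuples n := fun u =>
    (⟨firstTuple j u, fun i => u.2.1 _, firstTuple_injective u.2.2⟩,
      ⟨secondTuple j u, fun i => by
        obtain ⟨k, -, hk⟩ := exists_secondTuple_eq (T := T) j i
        rw [hk]
        exact u.2.1 _, secondTuple_injective u.2.2⟩)
  have hF : Function.Injective F := fun u v h => Subtype.ext <|
    eq_of_firstTuple_eq_of_secondTuple_eq (congrArg Subtype.val (congrArg Prod.fst h))
      (congrArg Subtype.val (congrArg Prod.snd h))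
  calc _ = ∑' u, (fun p : z.tuples n × z.tuples n =>
        ‖symmetrize f p.1‖ₑ * ‖symmetrize f p.2‖ₑ) (F u) := by simp [F, enorm_mul]
    _ ≤ ∑' p : z.tuples n × z.tuples n, ‖symmetrize f p.1‖ₑ * ‖symmetrize f p.2‖ₑ :=
        ENNReal.tsum_comp_le_tsum_of_injective hF _
    _ = (∑' u : z.tuples n, ‖symmetrize f u‖ₑ) ^ 2 := by
        rw [ENNReal.tsum_prod (f := fun x y : z.tuples n => ‖symmetrize f x‖ₑ * ‖symmetrize f y‖ₑ)]
        simp_rw [ENNReal.tsum_mul_left, ENNReal.tsum_mul_right, sq]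
    _ ≤ _ := by exact pow_le_pow_left' (tsum_enorm_symmetrize_le z f) 2

theorem summable_of_tsum_enorm_lt_top {α : Type*} {f : α → ℝ} (h : ∑' a, ‖f a‖ₑ < ∞) :
    Summable f := by
  refine Summable.of_norm ?_
  have := ENNReal.summable_toReal h.ne
  simpa using this

/-- The square of a sum over `n`-tuples, sorted by the number of common points. -/
theorem tsum_tuples_sq {z : Config T} {f : (Fin n → T) → ℝ}
    (hf : ∑' u : z.tuples n, ‖f u‖ₑ < ∞) :
    (∑' u : z.tuples n, f u) ^ 2 = ∑ j : Fin (n + 1),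
      ((j : ℕ).factorial : ℝ) * (n.choose j : ℝ) ^ 2 * ∑' u : z.tuples (2 * n - j),
        symmetrize f (firstTuple j u) * symmetrize f (secondTuple j u) := by
  have hs : Summable fun u : z.tuples n => symmetrize f u :=
    summable_of_tsum_enorm_lt_top ((tsum_enorm_symmetrize_le z f).trans_lt hf)
  have hsum := (hasSum_symmetrize (summable_of_tsum_enorm_lt_top hf).hasSum).tsum_eq
  have hm : Summable fun p : z.tuples n × z.tuples n => symmetrize f p.1 * symmetrize f p.2 :=
    summable_mul_of_summable_norm (f := fun x : z.tuples n => symmetrize f x)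
      (g := fun x : z.tuples n => symmetrize f x) hs.norm hs.norm
  have h1 := hasSum_pairs_of_tuples z (G := fun x y => symmetrize f x * symmetrize f y)
    (fun σ τ x y => by rw [symmetrize_permInvariant, symmetrize_permInvariant])
    fun j => (summable_of_tsum_enorm_lt_top ((tsum_enorm_symmetrize_pair_le z f j).trans_lt
      (ENNReal.pow_lt_top hf))).hasSum
  calc (∑' u : z.tuples n, f u) ^ 2
      = (∑' u : z.tuples n, symmetrize f u) * ∑' u : z.tuples n, symmetrize f u := by
        rw [← hsum, sq]
    _ = ∑' p : z.tuples n × z.tuples n, symmetrize f p.1 * symmetrize f p.2 :=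
        hs.tsum_mul_tsum hs hm
    _ = _ := h1.tsum_eq
    _ = _ := Finset.sum_congr rfl fun j _ => by rw [nsmul_eq_mul]; push_cast; rfl

end Symmetrize

/-! ### Campbell formulas -/

/-- The Campbell formula of order `k` for the point process `Z`, jointly with the random element
`Y`: the weight `w` plays the role of a product density (`Y` constant) or of the conditional
intensity of the retained points (`Y` the discarded points). -/
def CampbellFormula {S Ω E : Type*} [Bornology S] [MeasurableSpace S] [MeasurableSpace Ω]
    [MeasurableSpace E] (μ : Measure S) (P : Measure Ω) (Z : Ω → Config S) (Y : Ω → E) (k : ℕ)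
    (w : (Fin k → S) → Ω → ℝ≥0) : Prop :=
  Measurable (Function.uncurry w) ∧
  ∀ g : (Fin k → S) → E → ℝ≥0∞, Measurable (Function.uncurry g) →
    ∫⁻ ω, ∑' x : (Z ω).tuples k, g x (Y ω) ∂P =
      ∫⁻ u, ∫⁻ ω, g u (Y ω) * w u ω ∂P ∂(refMeasure μ k)

theorem tsum_eq_toReal_tsum_ofReal_sub {α : Type*} {f : α → ℝ} (h : ∑' a, ‖f a‖ₑ < ∞) :
    ∑' a, f a = (∑' a, ENNReal.ofReal (f a)).toReal - (∑' a, ENNReal.ofReal (-f a)).toReal := by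
  have hs := summable_of_tsum_enorm_lt_top h
  rw [ENNReal.tsum_toReal_eq fun _ => ENNReal.ofReal_ne_top,
    ENNReal.tsum_toReal_eq fun _ => ENNReal.ofReal_ne_top]
  simp_rw [ENNReal.toReal_ofReal']
  have h1 : Summable fun a => max (f a) 0 := by
    refine Summable.of_nonneg_of_le (fun a => le_max_right _ _) (fun a => ?_) hs.abs
    exact max_le (le_abs_self _) (abs_nonneg _)
  have h2 : Summable fun a => max (-f a) 0 := by
    refine Summable.of_nonneg_of_le (fun a => le_max_right _ _) (fun a => ?_) hs.abs
    exact max_le (neg_le_abs _) (abs_nonneg _)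
  rw [← h1.tsum_sub h2]
  refine tsum_congr fun a => ?_
  rcases le_total 0 (f a) with h | h <;> simp [h]

theorem lintegral_lt_top_of_sq {Ω : Type*} [MeasurableSpace Ω] {P : Measure Ω}
    [IsFiniteMeasure P] {F : Ω → ℝ≥0∞} (h : ∫⁻ ω, F ω ^ 2 ∂P < ∞) : ∫⁻ ω, F ω ∂P < ∞ := by
  have hle : ∀ a : ℝ≥0∞, a ≤ 1 + a ^ 2 := fun a => by
    rcases le_total a 1 with ha | ha
    · exact ha.trans le_self_add
    · calc a = a ^ 1 := (pow_one a).symm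
        _ ≤ a ^ 2 := pow_le_pow_right₀ ha (by norm_num)
        _ ≤ _ := le_add_self
  calc ∫⁻ ω, F ω ∂P ≤ ∫⁻ ω, 1 + F ω ^ 2 ∂P := lintegral_mono fun ω => hle _
    _ = P Set.univ + ∫⁻ ω, F ω ^ 2 ∂P := by
      rw [lintegral_add_left measurable_const, lintegral_const, one_mul]
    _ < ∞ := ENNReal.add_lt_top.2 ⟨measure_lt_top _ _, h⟩

section Measurability

variable {S Ω E : Type*} [MeasurableSpace S] [MeasurableSpace Ω] [MeasurableSpace E]

theorem measurable_mul_weight {Y : Ω → E} (hY : Measurable Y) {k : ℕ} {w : (Fin k → S) → Ω → ℝ≥0}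
    (hw : Measurable (Function.uncurry w)) {g : (Fin k → S) → E → ℝ}
    (hg : Measurable (Function.uncurry g)) :
    Measurable fun p : (Fin k → S) × Ω => g p.1 (Y p.2) * (w p.1 p.2 : ℝ) :=
  (hg.comp (measurable_fst.prodMk (hY.comp measurable_snd))).mul
    (measurable_coe_nnreal_real.comp hw)

theorem measurable_firstTuple {n : ℕ} (j : Fin (n + 1)) :
    Measurable (firstTuple (S := S) j) :=
  measurable_pi_iff.2 fun _ => measurable_pi_apply _

theorem measurable_secondTuple {n : ℕ} (j : Fin (n + 1)) :
    Measurable (secondTuple (S := S) j) := by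
  refine measurable_pi_iff.2 fun i => ?_
  obtain ⟨k, -, hk⟩ := exists_secondTuple_eq (T := S) j i
  simp_rw [hk]
  exact measurable_pi_apply _

theorem measurable_symmetrize {n : ℕ} {g : (Fin n → S) → E → ℝ}
    (hg : Measurable (Function.uncurry g)) :
    Measurable fun p : (Fin n → S) × E => symmetrize (fun u => g u p.2) p.1 := by
  unfold symmetrize
  refine (Finset.measurable_sum _ fun σ _ => ?_).const_mul _
  refine hg.comp (Measurable.prodMk (measurable_pi_iff.2 fun i => ?_) measurable_snd)
  exact (measurable_pi_apply _).comp measurable_fst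

end Measurability

namespace CampbellFormula

section Nonnegative

variable {S Ω E : Type*} [MetricSpace S] [MeasurableSpace S] [MeasurableSpace Ω]
  [MeasurableSpace E] {μ : Measure S} {P : Measure Ω} {Z : Ω → Config S} {Y : Ω → E}

/-- The Campbell formula for nonnegative functions, with the right side an integral over the
product space. -/
theorem lintegral_tsum [SFinite P] (hY : Measurable Y) {k : ℕ} {w : (Fin k → S) → Ω → ℝ≥0}
    (hC : CampbellFormula μ P Z Y k w) {g : (Fin k → S) → E → ℝ≥0∞}
    (hg : Measurable (Function.uncurry g)) :
    ∫⁻ ω, ∑' x : (Z ω).tuples k, g x (Y ω) ∂P =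
      ∫⁻ p : (Fin k → S) × Ω, g p.1 (Y p.2) * w p.1 p.2 ∂((refMeasure μ k).prod P) := by
  rw [hC.2 g hg, lintegral_prod]
  exact ((hg.comp (measurable_fst.prodMk (hY.comp measurable_snd))).mul
    (measurable_coe_nnreal_ennreal.comp hC.1)).aemeasurable

theorem lintegral_tsum_enorm [SFinite P] (hY : Measurable Y) {k : ℕ} {w : (Fin k → S) → Ω → ℝ≥0}
    (hC : CampbellFormula μ P Z Y k w) {g : (Fin k → S) → E → ℝ}
    (hg : Measurable (Function.uncurry g)) :
    ∫⁻ ω, ∑' x : (Z ω).tuples k, ‖g x (Y ω)‖ₑ ∂P =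
      ∫⁻ p : (Fin k → S) × Ω, ‖g p.1 (Y p.2) * (w p.1 p.2 : ℝ)‖ₑ ∂((refMeasure μ k).prod P) := by
  rw [lintegral_tsum hY hC (g := fun u y => ‖g u y‖ₑ) hg.enorm]
  refine lintegral_congr fun p => ?_
  simp [enorm_mul]

end Nonnegative

variable {S Ω E : Type*} [MetricSpace S] [SecondCountableTopology S] [MeasurableSpace S]
  [BorelSpace S] [MeasurableSpace Ω] [MeasurableSpace E] {μ : Measure S} {P : Measure Ω}
  {Z : Ω → Config S} {Y : Ω → E}

theorem measurable_tsum (hZ : Measurable Z) (hY : Measurable Y) {k : ℕ}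
    {g : (Fin k → S) → E → ℝ≥0∞} (hg : Measurable (Function.uncurry g)) :
    Measurable fun ω => ∑' x : (Z ω).tuples k, g x (Y ω) :=
  Config.measurable_tsum_tuples k hZ (g := fun u ω => g u (Y ω))
    (hg.comp (measurable_fst.prodMk (hY.comp measurable_snd)))

theorem ae_tsum_enorm_lt_top (hZ : Measurable Z) (hY : Measurable Y) {k : ℕ}
    {g : (Fin k → S) → E → ℝ} (hg : Measurable (Function.uncurry g))
    (hfin : ∫⁻ ω, ∑' x : (Z ω).tuples k, ‖g x (Y ω)‖ₑ ∂P < ∞) :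
    ∀ᵐ ω ∂P, ∑' x : (Z ω).tuples k, ‖g x (Y ω)‖ₑ < ∞ :=
  ae_lt_top (measurable_tsum hZ hY (g := fun u y => ‖g u y‖ₑ) hg.enorm) hfin.ne

variable [SigmaFinite μ] [IsProbabilityMeasure P]

/-- The Campbell formula for real functions with absolutely summable expected sum. -/
theorem integral_tsum (hZ : Measurable Z) (hY : Measurable Y) {k : ℕ}
    {w : (Fin k → S) → Ω → ℝ≥0} (hC : CampbellFormula μ P Z Y k w) {g : (Fin k → S) → E → ℝ}
    (hg : Measurable (Function.uncurry g))
    (hfin : ∫⁻ ω, ∑' x : (Z ω).tuples k, ‖g x (Y ω)‖ₑ ∂P < ∞) :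
    Integrable (fun p : (Fin k → S) × Ω => g p.1 (Y p.2) * (w p.1 p.2 : ℝ))
      ((refMeasure μ k).prod P) ∧
    Integrable (fun ω => ∑' x : (Z ω).tuples k, g x (Y ω)) P ∧
    ∫ ω, ∑' x : (Z ω).tuples k, g x (Y ω) ∂P =
      ∫ u, ∫ ω, g u (Y ω) * (w u ω : ℝ) ∂P ∂(refMeasure μ k) := by
  have hint : Integrable (fun p : (Fin k → S) × Ω => g p.1 (Y p.2) * (w p.1 p.2 : ℝ))
      ((refMeasure μ k).prod P) := by
    refine ⟨(measurable_mul_weight hY hC.1 hg).aestronglyMeasurable, ?_⟩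
    rw [HasFiniteIntegral, ← lintegral_tsum_enorm hY hC hg]
    exact hfin
  have hae := ae_tsum_enorm_lt_top hZ hY hg hfin
  have hpos : Measurable (Function.uncurry fun u y => ENNReal.ofReal (g u y)) := hg.ennreal_ofReal
  have hneg : Measurable (Function.uncurry fun u y => ENNReal.ofReal (-g u y)) :=
    hg.neg.ennreal_ofReal
  set N₁ := fun ω => ∑' x : (Z ω).tuples k, ENNReal.ofReal (g x (Y ω)) with hN₁
  set N₂ := fun ω => ∑' x : (Z ω).tuples k, ENNReal.ofReal (-g x (Y ω)) with hN₂
  have hm₁ : Measurable N₁ := measurable_tsum hZ hY hpos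
  have hm₂ : Measurable N₂ := measurable_tsum hZ hY hneg
  have hle₁ : ∀ ω, N₁ ω ≤ ∑' x : (Z ω).tuples k, ‖g x (Y ω)‖ₑ := fun ω =>
    ENNReal.tsum_le_tsum fun x => Real.ofReal_le_enorm _
  have hle₂ : ∀ ω, N₂ ω ≤ ∑' x : (Z ω).tuples k, ‖g x (Y ω)‖ₑ := fun ω =>
    ENNReal.tsum_le_tsum fun x => by
      rw [← enorm_neg (g x (Y ω))]
      exact Real.ofReal_le_enorm _
  have hf₁ : ∫⁻ ω, N₁ ω ∂P < ∞ := (lintegral_mono hle₁).trans_lt hfin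
  have hf₂ : ∫⁻ ω, N₂ ω ∂P < ∞ := (lintegral_mono hle₂).trans_lt hfin
  have hi₁ := integrable_toReal_of_lintegral_ne_top hm₁.aemeasurable hf₁.ne
  have hi₂ := integrable_toReal_of_lintegral_ne_top hm₂.aemeasurable hf₂.ne
  have heq : (fun ω => ∑' x : (Z ω).tuples k, g x (Y ω)) =ᵐ[P]
      fun ω => (N₁ ω).toReal - (N₂ ω).toReal := by
    filter_upwards [hae] with ω hω
    exact tsum_eq_toReal_tsum_ofReal_sub hω
  refine ⟨hint, (hi₁.sub hi₂).congr heq.symm, ?_⟩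
  rw [integral_congr_ae heq, integral_sub hi₁ hi₂,
    integral_toReal hm₁.aemeasurable (ae_lt_top hm₁ hf₁.ne),
    integral_toReal hm₂.aemeasurable (ae_lt_top hm₂ hf₂.ne), hN₁, hN₂,
    lintegral_tsum hY hC hpos, lintegral_tsum hY hC hneg, ← integral_prod _ hint,
    integral_eq_lintegral_pos_part_sub_lintegral_neg_part hint]
  congr 3
  · ext p
    rw [ENNReal.ofReal_mul' (NNReal.coe_nonneg _), ENNReal.ofReal_coe_nnreal]
  · ext p
    rw [← neg_mul, ENNReal.ofReal_mul' (NNReal.coe_nonneg _), ENNReal.ofReal_coe_nnreal]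

/-- The second moment of a sum over `n`-tuples: the square of the sum is a combination of sums
over `2n - j`-tuples, to each of which the Campbell formula applies. -/
theorem integral_tsum_sq (hZ : Measurable Z) (hY : Measurable Y) {n : ℕ}
    {w : (k : ℕ) → (Fin k → S) → Ω → ℝ≥0}
    (hC : ∀ k ∈ Finset.Icc n (2 * n), CampbellFormula μ P Z Y k (w k))
    {g : (Fin n → S) → E → ℝ} (hg : Measurable (Function.uncurry g))
    (hfin : ∫⁻ ω, (∑' x : (Z ω).tuples n, ‖g x (Y ω)‖ₑ) ^ 2 ∂P < ∞) :
    MemLp (fun ω => ∑' x : (Z ω).tuples n, g x (Y ω)) 2 P ∧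
    ∫ ω, (∑' x : (Z ω).tuples n, g x (Y ω)) ^ 2 ∂P = pairSum μ n fun j u =>
      ∫ ω, symmetrize (fun v => g v (Y ω)) (firstTuple j u) *
        symmetrize (fun v => g v (Y ω)) (secondTuple j u) * (w (2 * n - j) u ω : ℝ) ∂P := by
  have hfin1 := lintegral_lt_top_of_sq hfin
  have hN := (integral_tsum hZ hY (hC n (by simp; omega)) hg hfin1).2.1
  have hterm := fun j : Fin (n + 1) => integral_tsum hZ hY (hC (2 * n - j) (by simp; omega))
    (g := fun u y => symmetrize (fun v => g v y) (firstTuple j u) *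
      symmetrize (fun v => g v y) (secondTuple j u))
    (((measurable_symmetrize hg).comp
        (((measurable_firstTuple j).comp measurable_fst).prodMk measurable_snd)).mul
      ((measurable_symmetrize hg).comp
        (((measurable_secondTuple j).comp measurable_fst).prodMk measurable_snd)))
    ((lintegral_mono fun ω => tsum_enorm_symmetrize_pair_le (Z ω) (fun v => g v (Y ω)) j).trans_lt
      hfin)
  have hsq : (fun ω => (∑' x : (Z ω).tuples n, g x (Y ω)) ^ 2) =ᵐ[P] fun ω =>
      ∑ j : Fin (n + 1), ((j : ℕ).factorial : ℝ) * (n.choose j : ℝ) ^ 2 *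
        ∑' u : (Z ω).tuples (2 * n - j), symmetrize (fun v => g v (Y ω)) (firstTuple j u) *
          symmetrize (fun v => g v (Y ω)) (secondTuple j u) := by
    filter_upwards [ae_tsum_enorm_lt_top hZ hY hg hfin1] with ω hω
    exact tsum_tuples_sq (f := fun v => g v (Y ω)) hω
  have hint := fun j : Fin (n + 1) =>
    (hterm j).2.1.const_mul (((j : ℕ).factorial : ℝ) * (n.choose j : ℝ) ^ 2)
  refine ⟨(memLp_two_iff_integrable_sq hN.aestronglyMeasurable).2
    ((integrable_finsetSum _ fun j _ => hint j).congr hsq.symm), ?_⟩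
  rw [integral_congr_ae hsq, integral_finsetSum _ fun j _ => hint j, pairSum]
  refine Finset.sum_congr rfl fun j _ => ?_
  rw [integral_const_mul, (hterm j).2.2]

end CampbellFormula

/-- Fubini's theorem in the form in which the compensator enters the second moment. -/
theorem integral_integral_integral_mul {α β Ω : Type*} [MeasurableSpace α] [MeasurableSpace β]
    [MeasurableSpace Ω] {a : Measure α} {b : Measure β} {P : Measure Ω} [SFinite a] [SFinite b]
    [SFinite P] {G : α → Ω → ℝ} {q : β → Ω → ℝ} (hG : Measurable (Function.uncurry G))
    (hq : Measurable (Function.uncurry q))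
    (h : ∫⁻ u, ∫⁻ ω, ‖G u ω‖ₑ * ∫⁻ v, ‖q v ω‖ₑ ∂b ∂P ∂a < ∞) :
    ∫ u, ∫ v, ∫ ω, G u ω * q v ω ∂P ∂b ∂a = ∫ u, ∫ ω, G u ω * ∫ v, q v ω ∂b ∂P ∂a := by
  have hQ : Measurable fun ω => ∫⁻ v, ‖q v ω‖ₑ ∂b := hq.enorm.lintegral_prod_left'
  have hm : Measurable fun u => ∫⁻ ω, ‖G u ω‖ₑ * ∫⁻ v, ‖q v ω‖ₑ ∂b ∂P :=
    (hG.enorm.mul (hQ.comp measurable_snd)).lintegral_prod_right'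
  refine integral_congr_ae ?_
  filter_upwards [ae_lt_top hm h.ne] with u hu
  have hqs : ∀ ω, Measurable fun v => ‖q v ω‖ₑ := fun ω =>
    (hq.comp measurable_prodMk_right).enorm
  have hF : Measurable fun p : β × Ω => G u p.2 * q p.1 p.2 :=
    (hG.comp (measurable_const.prodMk measurable_snd)).mul hq
  rw [integral_integral_swap (f := fun v ω => G u ω * q v ω)]
  · simp_rw [integral_const_mul]
  · refine ⟨hF.aestronglyMeasurable, ?_⟩
    have hF' : AEMeasurable (fun p : β × Ω => ‖Function.uncurry (fun v ω => G u ω * q v ω) p‖ₑ)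
        (b.prod P) := hF.enorm.aemeasurable
    rw [HasFiniteIntegral, lintegral_prod_symm _ hF']
    refine lt_of_eq_of_lt (lintegral_congr fun ω => ?_) hu
    simp only [Function.uncurry, enorm_mul]
    exact lintegral_const_mul _ (hqs ω)

/-! ### Moments of the innovation -/

section Indicator

variable {α Ω E : Type*} [MeasurableSpace α] [MeasurableSpace Ω] [MeasurableSpace E]

theorem measurable_uncurry_indicator {A : Set α} (hA : MeasurableSet A) {h : α → E → ℝ}
    (hh : Measurable (Function.uncurry h)) :
    Measurable (Function.uncurry fun u y => A.indicator (fun v => h v y) u) := by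
  convert hh.indicator (hA.preimage measurable_fst) using 1
  ext ⟨u, y⟩
  by_cases hu : u ∈ A <;> simp [hu]

theorem integrable_indicator_mul_iff {ν : Measure α} [SFinite ν] {P : Measure Ω} [SFinite P]
    {A : Set α} (hA : MeasurableSet A) {h W : α → Ω → ℝ} :
    Integrable (fun p : α × Ω => A.indicator (fun v => h v p.2) p.1 * W p.1 p.2) (ν.prod P) ↔
      Integrable (fun p : α × Ω => h p.1 p.2 * W p.1 p.2) ((ν.restrict A).prod P) := by
  have h1 : (ν.restrict A).prod P = (ν.prod P).restrict (A ×ˢ Set.univ) := by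
    rw [← Measure.prod_restrict, Measure.restrict_univ]
  rw [h1, ← IntegrableOn, ← integrable_indicator_iff (hA.prod MeasurableSet.univ)]
  congr! 1
  ext ⟨u, ω⟩
  by_cases hu : u ∈ A <;> simp [hu]

theorem integral_indicator_mul {ν : Measure α} {P : Measure Ω} {A : Set α} (hA : MeasurableSet A)
    {h W : α → Ω → ℝ} :
    ∫ u, ∫ ω, A.indicator (fun v => h v ω) u * W u ω ∂P ∂ν =
      ∫ u in A, ∫ ω, h u ω * W u ω ∂P ∂ν := by
  rw [← integral_indicator hA]
  congr 1 with u
  by_cases hu : u ∈ A <;> simp [hu]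

end Indicator

namespace CampbellFormula

variable {S Ω E : Type*} [MetricSpace S] [SecondCountableTopology S] [MeasurableSpace S]
  [BorelSpace S] [MeasurableSpace Ω] [MeasurableSpace E] {μ : Measure S} [SigmaFinite μ]
  {P : Measure Ω} [IsProbabilityMeasure P] {Z : Ω → Config S} {Y : Ω → E}

theorem integral_innovation (hZ : Measurable Z) (hY : Measurable Y) {n : ℕ}
    {w : (Fin n → S) → Ω → ℝ≥0} (hC : CampbellFormula μ P Z Y n w)
    {h ξ : (Fin n → S) → E → ℝ} (hh : Measurable (Function.uncurry h))
    {A : Set (Fin n → S)} (hA : MeasurableSet A)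
    (h1 : Integrable (fun p : (Fin n → S) × Ω => h p.1 (Y p.2) * (w p.1 p.2 : ℝ))
      (((refMeasure μ n).restrict A).prod P))
    (h2 : Integrable (fun p : (Fin n → S) × Ω => h p.1 (Y p.2) * ξ p.1 (Y p.2))
      (((refMeasure μ n).restrict A).prod P)) :
    Integrable (fun ω => ∑' x : (Z ω).tuples n, A.indicator (fun v => h v (Y ω)) x -
      ∫ u in A, h u (Y ω) * ξ u (Y ω) ∂(refMeasure μ n)) P ∧
    ∫ ω, (∑' x : (Z ω).tuples n, A.indicator (fun v => h v (Y ω)) x -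
      ∫ u in A, h u (Y ω) * ξ u (Y ω) ∂(refMeasure μ n)) ∂P =
      ∫ u in A, ∫ ω, h u (Y ω) * (w u ω - ξ u (Y ω)) ∂P ∂(refMeasure μ n) := by
  have hg := measurable_uncurry_indicator hA hh
  have h1' := (integrable_indicator_mul_iff (ν := refMeasure μ n) (P := P) hA
    (h := fun v ω => h v (Y ω)) (W := fun u ω => (w u ω : ℝ))).2 h1
  have hN := integral_tsum hZ hY hC hg (by
    rw [lintegral_tsum_enorm hY hC hg]
    exact h1'.2)
  have hI : Integrable (fun ω => ∫ u in A, h u (Y ω) * ξ u (Y ω) ∂(refMeasure μ n)) P :=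
    h2.integral_prod_right
  refine ⟨hN.2.1.sub hI, ?_⟩
  rw [integral_sub hN.2.1 hI, hN.2.2,
    integral_indicator_mul hA (h := fun v ω => h v (Y ω)) (W := fun u ω => (w u ω : ℝ)),
    ← integral_integral_swap (f := fun u ω => h u (Y ω) * ξ u (Y ω)) h2,
    ← integral_sub h1.integral_prod_left h2.integral_prod_left]
  refine integral_congr_ae ?_
  filter_upwards [h1.prod_right_ae, h2.prod_right_ae] with u hu1 hu2
  rw [← integral_sub hu1 hu2]
  simp_rw [mul_sub]

theorem ennreal_mul_le_sq_add_sq (a b : ℝ≥0∞) : a * b ≤ a ^ 2 + b ^ 2 := by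
  rcases le_total a b with h | h
  · calc a * b ≤ b * b := by gcongr
      _ = b ^ 2 := (sq b).symm
      _ ≤ _ := le_add_self
  · calc a * b ≤ a * a := by gcongr
      _ = a ^ 2 := (sq a).symm
      _ ≤ _ := le_self_add

/-- The second moment of the innovation: the square of the sum is treated by `integral_tsum_sq`,
the mixed term by the Campbell formula for the product of the summand with the compensator, which
is a function of `Y`, and the square of the compensator by Fubini's theorem. -/
theorem integral_innovation_sq (hZ : Measurable Z) (hY : Measurable Y) {n : ℕ}
    {w : (k : ℕ) → (Fin k → S) → Ω → ℝ≥0}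
    (hC : ∀ k ∈ Finset.Icc n (2 * n), CampbellFormula μ P Z Y k (w k))
    {h ξ : (Fin n → S) → E → ℝ} (hh : Measurable (Function.uncurry h))
    (hξ : Measurable (Function.uncurry ξ)) {A : Set (Fin n → S)} (hA : MeasurableSet A)
    (h1 : ∫⁻ ω, (∑' x : (Z ω).tuples n, ‖A.indicator (fun v => h v (Y ω)) x‖ₑ) ^ 2 ∂P < ∞)
    (h2 : ∫⁻ ω, (∫⁻ u in A, ‖h u (Y ω) * ξ u (Y ω)‖ₑ ∂(refMeasure μ n)) ^ 2 ∂P < ∞) :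
    MemLp (fun ω => ∑' x : (Z ω).tuples n, A.indicator (fun v => h v (Y ω)) x -
      ∫ u in A, h u (Y ω) * ξ u (Y ω) ∂(refMeasure μ n)) 2 P ∧
    ∫ ω, (∑' x : (Z ω).tuples n, A.indicator (fun v => h v (Y ω)) x -
      ∫ u in A, h u (Y ω) * ξ u (Y ω) ∂(refMeasure μ n)) ^ 2 ∂P =
      pairSum μ n (fun j u =>
        ∫ ω, symmetrize (A.indicator fun v => h v (Y ω)) (firstTuple j u) *
          symmetrize (A.indicator fun v => h v (Y ω)) (secondTuple j u) *
          (w (2 * n - j) u ω : ℝ) ∂P) +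
      (∫ u in A, ∫ v in A, ∫ ω, h u (Y ω) * h v (Y ω) * ξ u (Y ω) * ξ v (Y ω) ∂P
        ∂(refMeasure μ n) ∂(refMeasure μ n)) -
      2 * (∫ u in A, ∫ v in A, ∫ ω, h u (Y ω) * h v (Y ω) * ξ v (Y ω) * (w n u ω : ℝ) ∂P
        ∂(refMeasure μ n) ∂(refMeasure μ n)) := by
  set ν := refMeasure μ n
  have hCn := hC n (by simp; omega)
  have hg := measurable_uncurry_indicator hA hh
  obtain ⟨hNmem, hNsq⟩ := integral_tsum_sq hZ hY hC hg h1
  set N : Ω → ℝ := fun ω => ∑' x : (Z ω).tuples n, A.indicator (fun v => h v (Y ω)) x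
  -- the compensator and its absolute version, as functions of `Y`
  have hhξ : Measurable (Function.uncurry fun u y => h u y * ξ u y) := hh.mul hξ
  let c : E → ℝ := fun y => ∫ u in A, h u y * ξ u y ∂ν
  let d : E → ℝ≥0∞ := fun y => ∫⁻ u in A, ‖h u y * ξ u y‖ₑ ∂ν
  have hc : Measurable c := by
    have : StronglyMeasurable (Function.uncurry fun y u => h u y * ξ u y) :=
      (hhξ.comp measurable_swap).stronglyMeasurable
    exact this.integral_prod_right.measurable
  have hd : Measurable d := hhξ.enorm.lintegral_prod_left'
  have hcd : ∀ y, ‖c y‖ₑ ≤ d y := fun y => enorm_integral_le_lintegral_enorm _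
  have hq : Measurable (Function.uncurry fun u ω => h u (Y ω) * ξ u (Y ω)) :=
    hhξ.comp (measurable_fst.prodMk (hY.comp measurable_snd))
  have hcmem : MemLp (fun ω => c (Y ω)) 2 P := by
    refine (memLp_two_iff_integrable_sq (hc.comp hY).aestronglyMeasurable).2
      ⟨((hc.comp hY).pow_const 2).aestronglyMeasurable, ?_⟩
    refine lt_of_le_of_lt (lintegral_mono fun ω => ?_) h2
    rw [enorm_pow]
    gcongr
    exact hcd _
  -- the square of the compensator
  have hcsq : ∫ u in A, ∫ v in A, ∫ ω, h u (Y ω) * h v (Y ω) * ξ u (Y ω) * ξ v (Y ω) ∂P ∂ν ∂ν =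
      ∫ ω, c (Y ω) ^ 2 ∂P := by
    have hswap : ∫⁻ u in A, ∫⁻ ω, ‖h u (Y ω) * ξ u (Y ω)‖ₑ * d (Y ω) ∂P ∂ν =
        ∫⁻ ω, d (Y ω) ^ 2 ∂P := by
      rw [lintegral_lintegral_swap (hq.enorm.mul
        ((hd.comp hY).comp measurable_snd)).aemeasurable]
      refine lintegral_congr fun ω => ?_
      have hm : Measurable fun u => ‖h u (Y ω) * ξ u (Y ω)‖ₑ :=
        (hhξ.comp measurable_prodMk_right).enorm
      rw [lintegral_mul_const _ hm, sq]
    have key := integral_integral_integral_mul (a := ν.restrict A) (b := ν.restrict A) (P := P)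
      hq hq (lt_of_eq_of_lt hswap h2)
    have hint : Integrable (Function.uncurry fun u ω => h u (Y ω) * ξ u (Y ω) * c (Y ω))
        ((ν.restrict A).prod P) := by
      have hm : Measurable (Function.uncurry fun u ω => h u (Y ω) * ξ u (Y ω) * c (Y ω)) :=
        hq.mul ((hc.comp hY).comp measurable_snd)
      refine ⟨hm.aestronglyMeasurable, ?_⟩
      rw [HasFiniteIntegral, lintegral_prod _ hm.enorm.aemeasurable]
      refine lt_of_le_of_lt (lintegral_mono fun u => lintegral_mono fun ω => ?_)
        (lt_of_eq_of_lt hswap h2)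
      simp only [Function.uncurry, enorm_mul]
      gcongr
      exact hcd _
    calc _ = ∫ u in A, ∫ v in A, ∫ ω,
          h u (Y ω) * ξ u (Y ω) * (h v (Y ω) * ξ v (Y ω)) ∂P ∂ν ∂ν := by
          congr! 6
          ring
      _ = ∫ u in A, ∫ ω, h u (Y ω) * ξ u (Y ω) * c (Y ω) ∂P ∂ν := key
      _ = ∫ ω, ∫ u in A, h u (Y ω) * ξ u (Y ω) * c (Y ω) ∂ν ∂P := integral_integral_swap hint
      _ = _ := by
          congr 1 with ω
          rw [integral_mul_const, sq]
  -- the mixed term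
  have hND : ∫⁻ ω, ∑' x : (Z ω).tuples n,
      ‖A.indicator (fun v => h v (Y ω)) x‖ₑ * d (Y ω) ∂P < ∞ := by
    have hm := measurable_tsum hZ hY (g := fun u y => ‖A.indicator (fun v => h v y) u‖ₑ) hg.enorm
    calc _ ≤ ∫⁻ ω, (∑' x : (Z ω).tuples n, ‖A.indicator (fun v => h v (Y ω)) x‖ₑ) ^ 2 +
          d (Y ω) ^ 2 ∂P := lintegral_mono fun ω => by
            rw [ENNReal.tsum_mul_right]
            exact ennreal_mul_le_sq_add_sq _ _
      _ = _ := lintegral_add_left (hm.pow_const 2) _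
      _ < ∞ := ENNReal.add_lt_top.2 ⟨h1, h2⟩
  have hmix : ∫ u in A, ∫ v in A, ∫ ω,
      h u (Y ω) * h v (Y ω) * ξ v (Y ω) * (w n u ω : ℝ) ∂P ∂ν ∂ν = ∫ ω, N ω * c (Y ω) ∂P := by
    have hgc : Measurable (Function.uncurry fun u y => A.indicator (fun v => h v y) u * c y) :=
      hg.mul (hc.comp measurable_snd)
    have hcamp := integral_tsum hZ hY hCn hgc <| by
      refine lt_of_le_of_lt (lintegral_mono fun ω => ENNReal.tsum_le_tsum fun x => ?_) hND
      rw [enorm_mul]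
      gcongr
      exact hcd _
    have hG : Measurable (Function.uncurry fun u ω => h u (Y ω) * (w n u ω : ℝ)) :=
      measurable_mul_weight hY hCn.1 hh
    have hfin : ∫⁻ u in A, ∫⁻ ω, ‖h u (Y ω) * (w n u ω : ℝ)‖ₑ * d (Y ω) ∂P ∂ν < ∞ := by
      rw [hCn.2 (fun u y => ‖A.indicator (fun v => h v y) u‖ₑ * d y)
        (hg.enorm.mul (hd.comp measurable_snd))] at hND
      rw [← lintegral_indicator hA]
      refine lt_of_le_of_lt (lintegral_mono fun u => ?_) hND
      by_cases hu : u ∈ A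
      · simp only [hu, Set.indicator_of_mem]
        refine le_of_eq (lintegral_congr fun ω => ?_)
        simp only [enorm_mul, NNReal.enorm_eq]
        ring
      · simp [hu]
    calc _ = ∫ u in A, ∫ v in A, ∫ ω,
          h u (Y ω) * (w n u ω : ℝ) * (h v (Y ω) * ξ v (Y ω)) ∂P ∂ν ∂ν := by
          congr! 6
          ring
      _ = ∫ u in A, ∫ ω, h u (Y ω) * (w n u ω : ℝ) * c (Y ω) ∂P ∂ν :=
          integral_integral_integral_mul (a := ν.restrict A) (b := ν.restrict A) (P := P)
            hG hq hfin
      _ = ∫ u in A, ∫ ω, h u (Y ω) * (c (Y ω) * (w n u ω : ℝ)) ∂P ∂ν := by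
          congr! 4
          ring
      _ = ∫ u, ∫ ω, A.indicator (fun v => h v (Y ω)) u * (c (Y ω) * (w n u ω : ℝ)) ∂P ∂ν :=
          (integral_indicator_mul hA (h := fun v ω => h v (Y ω))
            (W := fun u ω => c (Y ω) * (w n u ω : ℝ))).symm
      _ = ∫ u, ∫ ω, A.indicator (fun v => h v (Y ω)) u * c (Y ω) * (w n u ω : ℝ) ∂P ∂ν := by
          simp_rw [mul_assoc]
      _ = ∫ ω, ∑' x : (Z ω).tuples n, A.indicator (fun v => h v (Y ω)) x * c (Y ω) ∂P :=
          hcamp.2.2.symm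
      _ = _ := by
          congr 1 with ω
          exact tsum_mul_right
  refine ⟨hNmem.sub hcmem, ?_⟩
  have hi1 : Integrable (fun ω => N ω ^ 2) P := hNmem.integrable_sq
  have hi2 : Integrable (fun ω => c (Y ω) ^ 2) P := hcmem.integrable_sq
  have hi3 : Integrable (fun ω => N ω * c (Y ω)) P := hNmem.integrable_mul hcmem
  rw [hcsq, hmix, ← hNsq, ← integral_const_mul, ← integral_add hi1 hi2,
    ← integral_sub (f := fun ω => N ω ^ 2 + c (Y ω) ^ 2) (hi1.add hi2) (hi3.const_mul 2)]
  congr 1 with ω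
  change (N ω - c (Y ω)) ^ 2 = N ω ^ 2 + c (Y ω) ^ 2 - 2 * (N ω * c (Y ω))
  ring

end CampbellFormula

/-! ### Vanishing expected innovations -/

/-- Two integrals over the events `{Y ∈ D}` that agree on a π-system of sets `D` agree for all
measurable `D`. -/
theorem setIntegral_preimage_eq_of_piSystem {Ω E : Type*} [MeasurableSpace Ω]
    [mE : MeasurableSpace E] {P : Measure Ω} {Y : Ω → E} (hY : Measurable Y) {C : Set (Set E)}
    (hC : IsPiSystem C) (hgen : mE = MeasurableSpace.generateFrom C) {f g : Ω → ℝ}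
    (hf : Integrable f P) (hg : Integrable g P) (huniv : ∫ ω, f ω ∂P = ∫ ω, g ω ∂P)
    (heq : ∀ D ∈ C, ∫ ω in Y ⁻¹' D, f ω ∂P = ∫ ω in Y ⁻¹' D, g ω ∂P) {D : Set E}
    (hD : MeasurableSet D) : ∫ ω in Y ⁻¹' D, f ω ∂P = ∫ ω in Y ⁻¹' D, g ω ∂P := by
  induction D, hD using MeasurableSpace.induction_on_inter hgen hC with
  | empty => simp
  | basic D hD => exact heq D hD
  | compl D hD ih =>
    have h1 := integral_add_compl (hY hD) hf
    have h2 := integral_add_compl (hY hD) hg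
    rw [Set.preimage_compl]
    linarith
  | iUnion D hdis hm ih =>
    have hdis' : Pairwise (Function.onFun Disjoint fun i => Y ⁻¹' D i) :=
      fun i j hij => (hdis hij).preimage Y
    rw [Set.preimage_iUnion, integral_iUnion (fun i => hY (hm i)) hdis' hf.integrableOn,
      integral_iUnion (fun i => hY (hm i)) hdis' hg.integrableOn]
    simp_rw [ih]

/-- The expected innovation, as given by `CampbellFormula.integral_innovation`, vanishes for all
test functions and sets if and only if `ξ(u; Y)` is the conditional expectation of the weight given
`Y`. For the direct implication, the indicators of countably many events `{Y ∈ D}` are used as test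
functions, multiplied by a positive function that makes all terms integrable. -/
theorem forall_integral_mul_sub_eq_zero_iff {α Ω E : Type*} [MeasurableSpace α]
    [MeasurableSpace Ω] [mE : MeasurableSpace E] {ν : Measure α} [SigmaFinite ν] {P : Measure Ω}
    [IsProbabilityMeasure P] {Y : Ω → E} (hY : Measurable Y)
    (hE : ∃ C : Set (Set E), C.Countable ∧ IsPiSystem C ∧ mE = MeasurableSpace.generateFrom C)
    {w : α → Ω → ℝ≥0} (hw : Measurable (Function.uncurry w)) {ξ : α → E → ℝ}
    (hξ : Measurable (Function.uncurry ξ))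
    (hwint : ∀ᵐ u ∂ν, Integrable (fun ω => (w u ω : ℝ)) P) :
    (∀ (h : α → E → ℝ) (A : Set α), Measurable (Function.uncurry h) → MeasurableSet A →
      (∀ᵐ u ∂ν, MemLp (fun ω => h u (Y ω)) 2 P) →
      Integrable (fun p : α × Ω => h p.1 (Y p.2) * (w p.1 p.2 : ℝ)) ((ν.restrict A).prod P) →
      Integrable (fun p : α × Ω => h p.1 (Y p.2) * ξ p.1 (Y p.2)) ((ν.restrict A).prod P) →
      ∫ u in A, ∫ ω, h u (Y ω) * (w u ω - ξ u (Y ω)) ∂P ∂ν = 0) ↔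
    ∀ᵐ u ∂ν, (fun ω => ξ u (Y ω)) =ᵐ[P]
      P[fun ω => (w u ω : ℝ) | MeasurableSpace.comap Y inferInstance] := by
  have hm : MeasurableSpace.comap Y inferInstance ≤ (inferInstance : MeasurableSpace Ω) :=
    hY.comap_le
  -- functions of `Y` are measurable with respect to the σ-algebra generated by `Y`
  have hYm : ∀ {f : E → ℝ}, Measurable f →
      StronglyMeasurable[MeasurableSpace.comap Y inferInstance] fun ω => f (Y ω) := fun hf =>
    (hf.comp (comap_measurable Y)).stronglyMeasurable
  have hwr : Measurable fun p : α × Ω => (w p.1 p.2 : ℝ) := measurable_coe_nnreal_real.comp hw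
  have hwu : ∀ u, Measurable fun ω => (w u ω : ℝ) := fun u => hwr.comp measurable_prodMk_left
  constructor
  · intro H
    obtain ⟨C, hCc, hCpi, hCgen⟩ := hE
    obtain ⟨b, hbpos, hbm, hbfin⟩ := exists_pos_lintegral_lt_of_sigmaFinite ν one_ne_zero
    have hbint : Integrable (fun u => (b u : ℝ)) ν := by
      refine ⟨(measurable_coe_nnreal_real.comp hbm).aestronglyMeasurable, ?_⟩
      simp only [HasFiniteIntegral, NNReal.enorm_eq]
      exact hbfin.trans ENNReal.one_lt_top
    let m : α → ℝ := fun u => ∫ ω, (w u ω : ℝ) ∂P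
    have hm0 : ∀ u, 0 ≤ m u := fun u => integral_nonneg fun ω => NNReal.coe_nonneg _
    have hmm : Measurable m :=
      (StronglyMeasurable.integral_prod_right (f := fun u ω => (w u ω : ℝ))
        hwr.stronglyMeasurable).measurable
    -- the factor `1 + |ξ|` makes the term with `ξ` integrable, the factor `1 + m` that with `w`
    let κ : α → E → ℝ := fun u y => b u / ((1 + |ξ u y|) * (1 + m u))
    have hκpos : ∀ u y, 0 < κ u y := fun u y => by
      have h1 : (0 : ℝ) < b u := hbpos u
      have h2 := hm0 u
      positivity
    have hκm : Measurable (Function.uncurry κ) :=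
      (measurable_coe_nnreal_real.comp (hbm.comp measurable_fst)).div
        ((measurable_const.add hξ.abs).mul (measurable_const.add (hmm.comp measurable_fst)))
    have hκ1 : ∀ u y, κ u y ≤ b u / (1 + m u) := fun u y => by
      have h2 := hm0 u
      have h3 := abs_nonneg (ξ u y)
      refine div_le_div_of_nonneg_left (NNReal.coe_nonneg _) (by positivity) ?_
      nlinarith
    have hκ2 : ∀ u y, κ u y ≤ b u := fun u y =>
      (hκ1 u y).trans (div_le_self (NNReal.coe_nonneg _) (by linarith [hm0 u]))
    have hκ3 : ∀ u y, |κ u y * ξ u y| ≤ b u := fun u y => by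
      have h2 := hm0 u
      have h3 := abs_nonneg (ξ u y)
      rw [abs_mul, abs_of_pos (hκpos u y)]
      simp only [κ]
      rw [div_mul_eq_mul_div, div_le_iff₀ (by positivity)]
      have h4 : |ξ u y| ≤ (1 + |ξ u y|) * (1 + m u) := by nlinarith [mul_nonneg h3 h2]
      exact mul_le_mul_of_nonneg_left h4 (NNReal.coe_nonneg _)
    have hpair : Measurable fun p : α × Ω => (p.1, Y p.2) :=
      measurable_fst.prodMk (hY.comp measurable_snd)
    have hκw : Integrable (fun p : α × Ω => κ p.1 (Y p.2) * (w p.1 p.2 : ℝ)) (ν.prod P) := by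
      have hmeas : Measurable fun p : α × Ω => κ p.1 (Y p.2) * (w p.1 p.2 : ℝ) :=
        (hκm.comp hpair).mul hwr
      refine (integrable_prod_iff hmeas.aestronglyMeasurable).2 ⟨?_, ?_⟩
      · filter_upwards [hwint] with u hu
        refine (hu.const_mul (b u : ℝ)).mono'
          (hmeas.comp measurable_prodMk_left).aestronglyMeasurable (ae_of_all _ fun ω => ?_)
        rw [Real.norm_of_nonneg (mul_nonneg (hκpos _ _).le (NNReal.coe_nonneg _))]
        exact mul_le_mul_of_nonneg_right (hκ2 _ _) (NNReal.coe_nonneg _)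
      · refine hbint.mono' (StronglyMeasurable.integral_prod_right
          (f := fun u ω => ‖κ u (Y ω) * (w u ω : ℝ)‖)
          hmeas.norm.stronglyMeasurable).aestronglyMeasurable ?_
        filter_upwards [hwint] with u hu
        rw [Real.norm_of_nonneg (integral_nonneg fun ω => norm_nonneg _)]
        calc ∫ ω, ‖κ u (Y ω) * (w u ω : ℝ)‖ ∂P
            ≤ ∫ ω, b u / (1 + m u) * (w u ω : ℝ) ∂P := by
              refine integral_mono_of_nonneg (ae_of_all _ fun ω => norm_nonneg _)
                (hu.const_mul _) (ae_of_all _ fun ω => ?_)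
              simp only
              rw [Real.norm_of_nonneg (mul_nonneg (hκpos _ _).le (NNReal.coe_nonneg _))]
              exact mul_le_mul_of_nonneg_right (hκ1 _ _) (NNReal.coe_nonneg _)
          _ = b u / (1 + m u) * m u := integral_const_mul _ _
          _ ≤ b u := by
              have h2 := hm0 u
              rw [div_mul_eq_mul_div, div_le_iff₀ (by positivity)]
              exact mul_le_mul_of_nonneg_left (by linarith) (NNReal.coe_nonneg _)
    have hκξ : Integrable (fun p : α × Ω => κ p.1 (Y p.2) * ξ p.1 (Y p.2)) (ν.prod P) :=
      (hbint.comp_fst P).mono' ((hκm.mul hξ).comp hpair).aestronglyMeasurable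
        (ae_of_all _ fun p => hκ3 _ _)
    -- the test functions `(u, y) ↦ 1{y ∈ D} κ(u, y)`
    have htest : ∀ D : Set E, MeasurableSet D → ∀ᵐ u ∂ν,
        ∫ ω in Y ⁻¹' D, κ u (Y ω) * (w u ω : ℝ) ∂P =
          ∫ ω in Y ⁻¹' D, κ u (Y ω) * ξ u (Y ω) ∂P := by
      intro D hD
      have hDm : MeasurableSet (Prod.snd ⁻¹' (Y ⁻¹' D) : Set (α × Ω)) := measurable_snd (hY hD)
      let h : α → E → ℝ := fun u y => D.indicator (κ u) y
      have hhm : Measurable (Function.uncurry h) := by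
        convert hκm.indicator (hD.preimage measurable_snd) using 1
        ext ⟨u, y⟩
        by_cases hy : y ∈ D <;> simp [h, hy]
      have hind : ∀ (W : α × Ω → ℝ), (fun p : α × Ω => h p.1 (Y p.2) * W p) =
          (Prod.snd ⁻¹' (Y ⁻¹' D)).indicator fun p => κ p.1 (Y p.2) * W p := by
        intro W
        ext ⟨u, ω⟩
        by_cases hy : Y ω ∈ D <;> simp [h, hy]
      have h1 : Integrable (fun p : α × Ω => h p.1 (Y p.2) * (w p.1 p.2 : ℝ)) (ν.prod P) := by
        rw [hind]
        exact hκw.indicator hDm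
      have h2 : Integrable (fun p : α × Ω => h p.1 (Y p.2) * ξ p.1 (Y p.2)) (ν.prod P) := by
        rw [hind fun p => ξ p.1 (Y p.2)]
        exact hκξ.indicator hDm
      have h12 : Integrable (fun p : α × Ω => h p.1 (Y p.2) * (w p.1 p.2 - ξ p.1 (Y p.2)))
          (ν.prod P) := by
        simp_rw [mul_sub]
        exact h1.sub h2
      have hmem : ∀ u, MemLp (fun ω => h u (Y ω)) 2 P := fun u => by
        refine MemLp.of_bound ((hhm.comp measurable_prodMk_left).comp hY).aestronglyMeasurable
          (b u) (ae_of_all _ fun ω => ?_)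
        by_cases hy : Y ω ∈ D
        · simpa [h, hy, abs_of_pos (hκpos u (Y ω))] using hκ2 u (Y ω)
        · simp [h, hy]
      have hzero := h12.integral_prod_left.ae_eq_zero_of_forall_setIntegral_eq_zero
        fun A hA _ => H h A hhm hA (ae_of_all _ hmem)
          (h1.mono_measure (Measure.prod_mono Measure.restrict_le_self le_rfl))
          (h2.mono_measure (Measure.prod_mono Measure.restrict_le_self le_rfl))
      filter_upwards [hzero, h1.prod_right_ae, h2.prod_right_ae] with u hu hu1 hu2
      have hset : ∀ W : Ω → ℝ, ∫ ω in Y ⁻¹' D, κ u (Y ω) * W ω ∂P =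
          ∫ ω, h u (Y ω) * W ω ∂P := fun W => by
        rw [← integral_indicator (hY hD)]
        congr 1 with ω
        by_cases hy : Y ω ∈ D <;> simp [h, hy]
      have hu' : ∫ ω, h u (Y ω) * ((w u ω : ℝ) - ξ u (Y ω)) ∂P = 0 := hu
      simp_rw [mul_sub] at hu'
      rw [integral_sub hu1 hu2, sub_eq_zero] at hu'
      rw [hset fun ω => (w u ω : ℝ), hset fun ω => ξ u (Y ω), hu']
    have hall : ∀ᵐ u ∂ν, ∀ D ∈ C, ∫ ω in Y ⁻¹' D, κ u (Y ω) * (w u ω : ℝ) ∂P =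
        ∫ ω in Y ⁻¹' D, κ u (Y ω) * ξ u (Y ω) ∂P :=
      (ae_ball_iff hCc).2 fun D hD => htest D <| by
        rw [hCgen]
        exact MeasurableSpace.measurableSet_generateFrom hD
    filter_upwards [hall, htest _ MeasurableSet.univ, hwint, hκw.prod_right_ae,
      hκξ.prod_right_ae] with u hu huniv huw hu1 hu2
    simp only [Set.preimage_univ, Measure.restrict_univ] at huniv
    have hκu : Measurable (κ u) := hκm.comp measurable_prodMk_left
    have hξu : Measurable (ξ u) := hξ.comp measurable_prodMk_left
    have hcond : (fun ω => κ u (Y ω) * ξ u (Y ω)) =ᵐ[P]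
        P[fun ω => κ u (Y ω) * (w u ω : ℝ) | MeasurableSpace.comap Y inferInstance] := by
      refine ae_eq_condExp_of_forall_setIntegral_eq hm hu1 (fun s _ _ => hu2.integrableOn) ?_
        (hYm (hκu.mul hξu)).aestronglyMeasurable
      rintro _ ⟨D, hD, rfl⟩ -
      exact (setIntegral_preimage_eq_of_piSystem hY hCpi hCgen hu1 hu2 huniv hu hD).symm
    have hpull := condExp_mul_of_stronglyMeasurable_left (hYm hκu) hu1 huw
    filter_upwards [hcond, hpull] with ω hω1 hω2
    refine mul_left_cancel₀ (hκpos u (Y ω)).ne' ?_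
    exact hω1.trans hω2
  · intro H h A hh hA _ h1 h2
    refine integral_eq_zero_of_ae ?_
    filter_upwards [ae_restrict_of_ae H, ae_restrict_of_ae hwint, h1.prod_right_ae,
      h2.prod_right_ae] with u hu huw hu1 hu2
    have hhu : Measurable (h u) := hh.comp measurable_prodMk_left
    have hpull := condExp_mul_of_stronglyMeasurable_left (hYm hhu) hu1 huw
    have key : ∫ ω, h u (Y ω) * ξ u (Y ω) ∂P = ∫ ω, h u (Y ω) * (w u ω : ℝ) ∂P := by
      rw [← integral_condExp hm (f := fun ω => h u (Y ω) * (w u ω : ℝ))]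
      refine integral_congr_ae ?_
      filter_upwards [hu, hpull] with ω hω1 hω2
      rw [hω1]
      exact hω2.symm
    simp_rw [mul_sub]
    rw [integral_sub hu1 hu2, key, sub_self]
    rfl

/-! ### Product densities and conditional intensities -/

/-- A product density satisfies the Campbell formula without auxiliary information. -/
theorem IsProductDensity.campbellFormula {S Ω : Type*} [Bornology S] [MeasurableSpace S]
    [MeasurableSpace Ω] {μ : Measure S} {P : Measure Ω} [IsProbabilityMeasure P]
    {Z : Ω → Config S} {k : ℕ} {ρ : (Fin k → S) → ℝ≥0} (h : IsProductDensity μ P Z k ρ) :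
    CampbellFormula μ P Z (fun _ => ()) k fun u _ => ρ u := by
  refine ⟨h.1.comp measurable_fst, fun g hg => ?_⟩
  rw [h.2 (fun u => g u ()) (hg.comp measurable_prodMk_right)]
  simp

section Papangelou

variable {S : Type*} [MeasurableSpace S]

/-- The tuple of marked points with all marks equal to 1. -/
def markOne {k : ℕ} (u : Fin k → S) : Fin k → S × Bool := fun i => (u i, true)

theorem measurable_markOne {k : ℕ} : Measurable (markOne : (Fin k → S) → Fin k → S × Bool) :=
  measurable_pi_iff.2 fun i => (measurable_pi_apply i).prodMk measurable_const

/-- On the tuples with all marks equal to 1, the reference measure of the marked space is the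
reference measure of the unmarked space. -/
theorem refMeasure_restrict_marks (μ : Measure S) [SigmaFinite μ] (k : ℕ) :
    (refMeasure (μ.prod (Measure.count : Measure Bool)) k).restrict
      (Set.univ.pi fun _ => Set.univ ×ˢ {true}) = (refMeasure μ k).map markOne := by
  have h1 : (μ.prod (Measure.count : Measure Bool)).restrict (Set.univ ×ˢ {true}) =
      μ.map fun s => (s, true) := by
    rw [← Measure.prod_restrict, Measure.restrict_univ, Measure.restrict_singleton,
      Measure.count_singleton, one_smul, Measure.prod_dirac]
  have h2 : SigmaFinite (μ.map fun s => (s, true)) := by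
    rw [← h1]
    infer_instance
  rw [Measure.restrict_pi_pi, h1]
  exact (Measure.pi_map_pi (hμ := fun _ => h2) fun _ =>
    (measurable_id.prodMk measurable_const).aemeasurable).symm

theorem lintegral_marks (μ : Measure S) [SigmaFinite μ] {k : ℕ} {g : (Fin k → S × Bool) → ℝ≥0∞}
    (hg : Measurable g) :
    ∫⁻ v, (Set.univ.pi fun _ => Set.univ ×ˢ {true}).indicator g v
      ∂(refMeasure (μ.prod (Measure.count : Measure Bool)) k) =
      ∫⁻ u, g (markOne u) ∂(refMeasure μ k) := by
  rw [lintegral_indicator, refMeasure_restrict_marks, lintegral_map hg measurable_markOne]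
  exact MeasurableSet.univ_pi fun _ => MeasurableSet.univ.prod (measurableSet_singleton _)

/-- A conditional intensity of the marked process, evaluated at the mark 1, satisfies the Campbell
formula for the retained points jointly with the discarded points: removing retained points does
not change the discarded ones. -/
theorem IsPapangelou.campbellFormula [Bornology S] {Ω : Type*} [MeasurableSpace Ω] {μ : Measure S}
    [SigmaFinite μ] {P : Measure Ω} [IsProbabilityMeasure P] {Xb : Ω → Config (S × Bool)}
    (hXb : Measurable Xb) {k : ℕ}
    {lam : (Fin k → S × Bool) → Config (S × Bool) → ℝ≥0}
    (h : IsPapangelou (μ.prod Measure.count) P Xb k lam) :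
    CampbellFormula μ P (fun ω => (Xb ω).retained) (fun ω => (Xb ω).unretained) k
      fun u ω => lam (markOne u) (Xb ω) := by
  refine ⟨h.1.comp ((measurable_markOne.comp measurable_fst).prodMk (hXb.comp measurable_snd)),
    fun g hg => ?_⟩
  set M : Set (Fin k → S × Bool) := Set.univ.pi fun _ => Set.univ ×ˢ {true}
  have hMm : MeasurableSet M :=
    MeasurableSet.univ_pi fun _ => MeasurableSet.univ.prod (measurableSet_singleton _)
  have hMmark : ∀ u : Fin k → S, markOne u ∈ M := fun u i _ => ⟨trivial, rfl⟩
  have hMfst : ∀ v ∈ M, v = markOne fun i => (v i).1 := fun v hv => by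
    ext i : 1
    exact Prod.ext rfl (hv i trivial).2
  let f : (Fin k → S × Bool) → Config (S × Bool) → ℝ≥0∞ := fun v x =>
    M.indicator (fun v => g (fun i => (v i).1) x.unretained) v
  have hfst : Measurable fun v : Fin k → S × Bool => fun i => (v i).1 :=
    measurable_pi_iff.2 fun i => measurable_fst.comp (measurable_pi_apply i)
  have hg' : Measurable fun p : (Fin k → S × Bool) × Config (S × Bool) =>
      g (fun i => (p.1 i).1) p.2.unretained :=
    hg.comp ((hfst.comp measurable_fst).prodMk
      (Config.measurable_unretained.comp measurable_snd))
  have hf : Measurable (Function.uncurry f) := by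
    convert hg'.indicator (hMm.preimage measurable_fst) using 1
    ext ⟨v, x⟩
    by_cases hv : v ∈ M <;> simp [f, hv]
  have key := h.2 f hf
  have hleft : ∀ ω, ∑' v : (Xb ω).tuples k, f v ((Xb ω).remove (Set.range v.1)) =
      ∑' u : (Xb ω).retained.tuples k, g u (Xb ω).unretained := by
    intro ω
    let F : (Xb ω).retained.tuples k → (Xb ω).tuples k := fun u =>
      ⟨markOne u, u.2.1, fun a b hab => u.2.2 (Prod.ext_iff.1 hab).1⟩
    have hF : Function.Injective F := fun u v huv => Subtype.ext <| funext fun i =>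
      (Prod.ext_iff.1 (congrFun (congrArg Subtype.val huv) i)).1
    rw [← hF.tsum_eq]
    · refine tsum_congr fun u => ?_
      have hun : ((Xb ω).remove (Set.range (markOne u.1))).unretained = (Xb ω).unretained := by
        refine Subtype.ext ?_
        ext s
        change (s, false) ∈ (Xb ω).pts \ Set.range (markOne u.1) ↔ (s, false) ∈ (Xb ω).pts
        refine ⟨fun hs => hs.1, fun hs => ⟨hs, ?_⟩⟩
        rintro ⟨i, hi⟩
        exact Bool.noConfusion (Prod.ext_iff.1 hi).2
      change M.indicator _ (markOne u.1) = _
      rw [Set.indicator_of_mem (hMmark _)]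
      change g u.1 ((Xb ω).remove (Set.range (markOne u.1))).unretained = _
      rw [hun]
    · intro v hv
      have hvM : v.1 ∈ M := by
        by_contra hvM
        exact hv (Set.indicator_of_notMem hvM _)
      have hv1 := hMfst _ hvM
      refine ⟨⟨fun i => (v.1 i).1, fun i => ?_, fun a b hab => v.2.2 ?_⟩, Subtype.ext hv1.symm⟩
      · change markOne (fun i => (v.1 i).1) i ∈ (Xb ω).pts
        rw [← hv1]
        exact v.2.1 i
      · rw [hv1]
        exact Prod.ext hab rfl
  simp_rw [hleft] at key
  have hright : ∀ v, ∫⁻ ω, f v (Xb ω) * lam v (Xb ω) ∂P = M.indicator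
      (fun v => ∫⁻ ω, g (fun i => (v i).1) (Xb ω).unretained * lam v (Xb ω) ∂P) v := by
    intro v
    by_cases hv : v ∈ M <;> simp [f, hv]
  have hG : Measurable fun v : Fin k → S × Bool =>
      ∫⁻ ω, g (fun i => (v i).1) (Xb ω).unretained * lam v (Xb ω) ∂P := by
    have hp : Measurable fun p : (Fin k → S × Bool) × Ω => (p.1, Xb p.2) :=
      measurable_fst.prodMk (hXb.comp measurable_snd)
    exact ((hg'.comp hp).mul
      (measurable_coe_nnreal_ennreal.comp (h.1.comp hp))).lintegral_prod_right'
  simp_rw [hright] at key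
  rw [lintegral_marks μ hG] at key
  exact key

end Papangelou

/-! ### Innovations as sums over tuples -/

theorem tsum_inter_eq_tsum_indicator {α M : Type*} [AddCommMonoid M] [TopologicalSpace M]
    (s A : Set α) (f : α → M) : ∑' x : ↥(s ∩ A), f x = ∑' x : s, A.indicator f x := by
  rw [tsum_subtype (s ∩ A) f, tsum_subtype s (A.indicator f), Set.indicator_indicator]

/-- Points of `z` are not among the points of `x \ z`. -/
theorem Config.remove_remove_range {T : Type*} [Bornology T] (x z : Config T) {n : ℕ}
    {u : Fin n → T} (hu : u ∈ z.tuples n) :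
    (x.remove z.pts).remove (Set.range u) = x.remove z.pts := by
  refine Subtype.ext ?_
  change (x.pts \ z.pts) \ Set.range u = x.pts \ z.pts
  refine sdiff_eq_left.2 (Set.disjoint_left.2 ?_)
  rintro _ hs ⟨i, rfl⟩
  exact hs.2 (hu.1 i)

/-- When the points of `z` do not occur in `y`, their removal from `y` is immaterial. -/
theorem innovation_eq {S : Type*} [Bornology S] [MeasurableSpace S] (μ : Measure S) {n : ℕ}
    (ξ h : (Fin n → S) → Config S → ℝ) (A : Set (Fin n → S)) {z y : Config S}
    (hzy : ∀ u ∈ z.tuples n, y.remove (Set.range u) = y) :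
    innovation μ ξ h A z y = ∑' x : z.tuples n, A.indicator (fun v => h v y) x -
      ∫ u in A, h u y * ξ u y ∂(refMeasure μ n) := by
  rw [innovation, ← tsum_inter_eq_tsum_indicator]
  congr 1
  exact tsum_congr fun x => by rw [hzy x x.2.1]

theorem univariateInnovation_eq {S : Type*} [Bornology S] [MeasurableSpace S] (μ : Measure S)
    {n : ℕ} (ξ h : (Fin n → S) → ℝ) (A : Set (Fin n → S)) (z : Config S) :
    univariateInnovation μ (fun u _ => ξ u) (fun u _ => h u) A z =
      ∑' x : z.tuples n, A.indicator h x - ∫ u in A, h u * ξ u ∂(refMeasure μ n) := by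
  rw [← tsum_inter_eq_tsum_indicator]
  rfl

/-! ### Innovations with deterministic weights -/

section Deterministic

variable {S Ω : Type*} [MetricSpace S] [SecondCountableTopology S] [MeasurableSpace S]
  [BorelSpace S] [MeasurableSpace Ω] {μ : Measure S} [SigmaFinite μ] {P : Measure Ω}
  [IsProbabilityMeasure P] {Z : Ω → Config S} {n : ℕ}

theorem integral_univariateInnovation (hZ : Measurable Z) {ξ : (Fin n → S) → ℝ}
    {ρ : (Fin n → S) → ℝ≥0} (hρ : IsProductDensity μ P Z n ρ) {h : (Fin n → S) → ℝ}
    {A : Set (Fin n → S)} (hh : Measurable h) (hA : MeasurableSet A)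
    (h1 : IntegrableOn (fun u => h u * ρ u) A (refMeasure μ n))
    (h2 : IntegrableOn (fun u => h u * ξ u) A (refMeasure μ n)) :
    Integrable (fun ω => univariateInnovation μ (fun u _ => ξ u) (fun u _ => h u) A (Z ω)) P ∧
    ∫ ω, univariateInnovation μ (fun u _ => ξ u) (fun u _ => h u) A (Z ω) ∂P =
      ∫ u in A, h u * (ρ u - ξ u) ∂(refMeasure μ n) := by
  have key := CampbellFormula.integral_innovation hZ measurable_const hρ.campbellFormula
    (h := fun u _ => h u) (ξ := fun u _ => ξ u) (hh.comp measurable_fst) hA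
    (Integrable.comp_fst h1 P) (Integrable.comp_fst h2 P)
  simp_rw [univariateInnovation_eq]
  refine ⟨key.1, key.2.trans ?_⟩
  simp

theorem variance_univariateInnovation (hZ : Measurable Z) {ξ : (Fin n → S) → ℝ}
    {ρ : (k : ℕ) → (Fin k → S) → ℝ≥0}
    (hρ : ∀ k ∈ Finset.Icc n (2 * n), IsProductDensity μ P Z k (ρ k)) {h : (Fin n → S) → ℝ}
    {A : Set (Fin n → S)} (hh : Measurable h) (hA : MeasurableSet A)
    (h1 : ∫⁻ ω, (∑' x : ↥((Z ω).tuples n ∩ A), ‖h x‖ₑ) ^ 2 ∂P < ∞) :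
    MemLp (fun ω => univariateInnovation μ (fun u _ => ξ u) (fun u _ => h u) A (Z ω)) 2 P ∧
    variance (fun ω => univariateInnovation μ (fun u _ => ξ u) (fun u _ => h u) A (Z ω)) P =
      pairSum μ n (fun j u => symmetrize (A.indicator h) (firstTuple j u) *
        symmetrize (A.indicator h) (secondTuple j u) * ρ (2 * n - j) u) -
      (∫ u in A, h u * ρ n u ∂(refMeasure μ n)) ^ 2 := by
  have hC : ∀ k ∈ Finset.Icc n (2 * n), CampbellFormula μ P Z (fun _ => ()) k fun u _ => ρ k u :=
    fun k hk => (hρ k hk).campbellFormula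
  have hg : Measurable (Function.uncurry fun u (_ : Unit) => A.indicator h u) :=
    (hh.indicator hA).comp measurable_fst
  have h1' : ∫⁻ ω, (∑' x : (Z ω).tuples n, ‖A.indicator h x‖ₑ) ^ 2 ∂P < ∞ := by
    simp_rw [tsum_inter_eq_tsum_indicator _ A fun x => ‖h x‖ₑ] at h1
    simpa only [enorm_indicator_eq_indicator_enorm] using h1
  obtain ⟨hmem, hsq⟩ := CampbellFormula.integral_tsum_sq hZ measurable_const
    (w := fun k u _ => ρ k u) hC hg h1'
  have hmean := (CampbellFormula.integral_tsum hZ measurable_const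
    (hC n (by simp; omega)) hg (lintegral_lt_top_of_sq h1')).2.2
  simp_rw [univariateInnovation_eq]
  refine ⟨hmem.sub (memLp_const _), ?_⟩
  rw [variance_sub_const hmem.aestronglyMeasurable, variance_eq_sub hmem]
  congr 1
  · refine hsq.trans ?_
    simp
  · rw [hmean, ← integral_indicator hA]
    congr 2 with u
    by_cases hu : u ∈ A <;> simp [hu]

theorem forall_integral_univariateInnovation_eq_zero_iff (hZ : Measurable Z)
    {ξ : (Fin n → S) → ℝ} (hξ : Measurable ξ) {ρ : (Fin n → S) → ℝ≥0}
    (hρ : IsProductDensity μ P Z n ρ) :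
    (∀ (h : (Fin n → S) → ℝ) (A : Set (Fin n → S)), Measurable h → MeasurableSet A →
      IntegrableOn (fun u => h u * ρ u) A (refMeasure μ n) →
      IntegrableOn (fun u => h u * ξ u) A (refMeasure μ n) →
      ∫ ω, univariateInnovation μ (fun u _ => ξ u) (fun u _ => h u) A (Z ω) ∂P = 0) ↔
    ∀ᵐ u ∂(refMeasure μ n), ξ u = ρ u := by
  -- without auxiliary information the conditional expectation of a constant is that constant
  have hUnit : ∃ C : Set (Set Unit), C.Countable ∧ IsPiSystem C ∧
      (inferInstance : MeasurableSpace Unit) = MeasurableSpace.generateFrom C :=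
    ⟨{s | MeasurableSet s}, Set.to_countable _, MeasurableSpace.isPiSystem_measurableSet,
      MeasurableSpace.generateFrom_measurableSet.symm⟩
  have key := forall_integral_mul_sub_eq_zero_iff (ν := refMeasure μ n) (P := P)
    (Y := fun _ => ()) measurable_const hUnit (w := fun u _ => ρ u) (hρ.1.comp measurable_fst)
    (ξ := fun u _ => ξ u) (hξ.comp measurable_fst) (ae_of_all _ fun u => integrable_const _)
  constructor
  · intro H
    have h' := key.1 fun h A hh hA _ h1 h2 => by
      have hh' : Measurable fun u => h u () := hh.comp measurable_prodMk_right
      have h1' : IntegrableOn (fun u => h u () * ρ u) A (refMeasure μ n) := by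
        simpa [IntegrableOn] using h1.integral_prod_left
      have h2' : IntegrableOn (fun u => h u () * ξ u) A (refMeasure μ n) := by
        simpa [IntegrableOn] using h2.integral_prod_left
      have h3 := H _ A hh' hA h1' h2'
      rw [(integral_univariateInnovation hZ hρ hh' hA h1' h2').2] at h3
      simpa using h3
    filter_upwards [h'] with u hu
    rw [condExp_const (Measurable.comap_le measurable_const)] at hu
    exact hu.exists.choose_spec
  · intro H h A hh hA h1 h2
    rw [(integral_univariateInnovation hZ hρ hh hA h1 h2).2]
    refine integral_eq_zero_of_ae ?_
    filter_upwards [ae_restrict_of_ae H] with u hu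
    simp [hu]

end Deterministic

/-! ### Innovations of a thinned process -/

theorem mainTheorem1
    {S : Type*} [MetricSpace S] [CompleteSpace S] [SecondCountableTopology S]
    [MeasurableSpace S] [BorelSpace S] (μ : Measure S) [IsLocallyFiniteMeasure μ]
    {Ω : Type*} [MeasurableSpace Ω] (P : Measure Ω) [IsProbabilityMeasure P]
    (X : Ω → Config S) (Xb : Ω → Config (S × Bool)) (hXb : IsBivariateMarking X Xb)
    (Z Y : Ω → Config S) (hZ : ∀ ω, Z ω = (Xb ω).retained)
    (hY : ∀ ω, Y ω = (X ω).remove (Z ω).pts)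
    (n : ℕ) (hn : 1 ≤ n) :
    -- `ξ` and `h` do not depend on the configuration
    (∀ (ξ : (Fin n → S) → ℝ) (ρ : (k : ℕ) → (Fin k → S) → ℝ≥0), Measurable ξ →
      IsProductDensity μ P Z n (ρ n) →
      (∀ (h : (Fin n → S) → ℝ) (A : Set (Fin n → S)), Measurable h → MeasurableSet A →
        -- the bivariate innovation is the univariate innovation of `Z`
        (∀ ω, innovation μ (fun u _ => ξ u) (fun u _ => h u) A (Z ω) (Y ω) =
          univariateInnovation μ (fun u _ => ξ u) (fun u _ => h u) A (Z ω)) ∧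
        -- expectation
        (IntegrableOn (fun u => h u * ρ n u) A (refMeasure μ n) →
          IntegrableOn (fun u => h u * ξ u) A (refMeasure μ n) →
          Integrable
            (fun ω => univariateInnovation μ (fun u _ => ξ u) (fun u _ => h u) A (Z ω)) P ∧
          ∫ ω, univariateInnovation μ (fun u _ => ξ u) (fun u _ => h u) A (Z ω) ∂P =
            ∫ u in A, h u * (ρ n u - ξ u) ∂(refMeasure μ n)) ∧
        -- variance
        ((∀ k ∈ Finset.Icc n (2 * n), IsProductDensity μ P Z k (ρ k)) →
          ∫⁻ ω, (∑' x : ↥((Z ω).tuples n ∩ A), ‖h x‖ₑ) ^ 2 ∂P < ∞ →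
          IntegrableOn (fun u => h u * ξ u) A (refMeasure μ n) →
          MemLp (fun ω => univariateInnovation μ (fun u _ => ξ u) (fun u _ => h u) A (Z ω)) 2 P ∧
          variance (fun ω => univariateInnovation μ (fun u _ => ξ u) (fun u _ => h u) A (Z ω)) P =
            pairSum μ n (fun j u => symmetrize (A.indicator h) (firstTuple j u) *
              symmetrize (A.indicator h) (secondTuple j u) * ρ (2 * n - j) u) -
            (∫ u in A, h u * ρ n u ∂(refMeasure μ n)) ^ 2 ∧
          (PermInvariant (A.indicator h) →
            variance
                (fun ω => univariateInnovation μ (fun u _ => ξ u) (fun u _ => h u) A (Z ω)) P =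
              pairSum μ n (fun j u => A.indicator h (firstTuple j u) *
                A.indicator h (secondTuple j u) * ρ (2 * n - j) u) -
              (∫ u in A, h u * ρ n u ∂(refMeasure μ n)) ^ 2))) ∧
      -- the expectation vanishes for all `A` and `h` iff `ξ` is the product density of `Z`
      ((∀ (h : (Fin n → S) → ℝ) (A : Set (Fin n → S)), Measurable h → MeasurableSet A →
          IntegrableOn (fun u => h u * ρ n u) A (refMeasure μ n) →
          IntegrableOn (fun u => h u * ξ u) A (refMeasure μ n) →
          ∫ ω, univariateInnovation μ (fun u _ => ξ u) (fun u _ => h u) A (Z ω) ∂P = 0) ↔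
        ∀ᵐ u ∂(refMeasure μ n), ξ u = ρ n u)) ∧
    -- `ξ` and `h` depend on the configuration
    (∀ (ξ : (Fin n → S) → Config S → ℝ)
      (lam : (k : ℕ) → (Fin k → S × Bool) → Config (S × Bool) → ℝ≥0),
      Measurable (Function.uncurry ξ) →
      IsPapangelou (μ.prod Measure.count) P Xb n (lam n) →
      (∀ (h : (Fin n → S) → Config S → ℝ) (A : Set (Fin n → S)),
        Measurable (Function.uncurry h) → MeasurableSet A →
        -- expectation
        (Integrable (fun p : (Fin n → S) × Ω => h p.1 (Y p.2) * atMarkOne (lam n) p.1 (Xb p.2))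
            (((refMeasure μ n).restrict A).prod P) →
          Integrable (fun p : (Fin n → S) × Ω => h p.1 (Y p.2) * ξ p.1 (Y p.2))
            (((refMeasure μ n).restrict A).prod P) →
          Integrable (fun ω => innovation μ ξ h A (Z ω) (Y ω)) P ∧
          ∫ ω, innovation μ ξ h A (Z ω) (Y ω) ∂P =
            ∫ u in A, ∫ ω, h u (Y ω) * (atMarkOne (lam n) u (Xb ω) - ξ u (Y ω)) ∂P
              ∂(refMeasure μ n)) ∧
        -- second moment
        ((∀ k ∈ Finset.Icc n (2 * n), IsPapangelou (μ.prod Measure.count) P Xb k (lam k)) →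
          ∫⁻ ω, (∑' x : ↥((Z ω).tuples n ∩ A),
            ‖h x ((Y ω).remove (Set.range x.1))‖ₑ) ^ 2 ∂P < ∞ →
          ∫⁻ ω, (∫⁻ u in A, ‖h u (Y ω) * ξ u (Y ω)‖ₑ ∂(refMeasure μ n)) ^ 2 ∂P < ∞ →
          MemLp (fun ω => innovation μ ξ h A (Z ω) (Y ω)) 2 P ∧
          ∫ ω, innovation μ ξ h A (Z ω) (Y ω) ^ 2 ∂P =
            pairSum μ n (fun j u =>
              ∫ ω, symmetrize (A.indicator fun v => h v (Y ω)) (firstTuple j u) *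
                symmetrize (A.indicator fun v => h v (Y ω)) (secondTuple j u) *
                atMarkOne (lam (2 * n - j)) u (Xb ω) ∂P) +
            (∫ u in A, ∫ v in A, ∫ ω,
              h u (Y ω) * h v (Y ω) * ξ u (Y ω) * ξ v (Y ω) ∂P
              ∂(refMeasure μ n) ∂(refMeasure μ n)) -
            2 * (∫ u in A, ∫ v in A, ∫ ω,
              h u (Y ω) * h v (Y ω) * ξ v (Y ω) * atMarkOne (lam n) u (Xb ω) ∂P
              ∂(refMeasure μ n) ∂(refMeasure μ n)) ∧
          ((∀ y : Config S, PermInvariant (A.indicator fun v => h v y)) →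
            ∫ ω, innovation μ ξ h A (Z ω) (Y ω) ^ 2 ∂P =
              pairSum μ n (fun j u =>
                ∫ ω, A.indicator (fun v => h v (Y ω)) (firstTuple j u) *
                  A.indicator (fun v => h v (Y ω)) (secondTuple j u) *
                  atMarkOne (lam (2 * n - j)) u (Xb ω) ∂P) +
              (∫ u in A, ∫ v in A, ∫ ω,
                h u (Y ω) * h v (Y ω) * ξ u (Y ω) * ξ v (Y ω) ∂P
                ∂(refMeasure μ n) ∂(refMeasure μ n)) -
              2 * (∫ u in A, ∫ v in A, ∫ ω,
                h u (Y ω) * h v (Y ω) * ξ v (Y ω) * atMarkOne (lam n) u (Xb ω) ∂P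
                ∂(refMeasure μ n) ∂(refMeasure μ n))))) ∧
      -- the expectation vanishes for all `A` and square integrable `h` iff `ξ` is the
      -- conditional expectation of the conditional intensity given `Y`
      ((∀ᵐ u ∂(refMeasure μ n), MemLp (fun ω => atMarkOne (lam n) u (Xb ω)) 2 P) →
        ((∀ (h : (Fin n → S) → Config S → ℝ) (A : Set (Fin n → S)),
            Measurable (Function.uncurry h) → MeasurableSet A →
            (∀ᵐ u ∂(refMeasure μ n), MemLp (fun ω => h u (Y ω)) 2 P) →
            Integrable
              (fun p : (Fin n → S) × Ω => h p.1 (Y p.2) * atMarkOne (lam n) p.1 (Xb p.2))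
              (((refMeasure μ n).restrict A).prod P) →
            Integrable (fun p : (Fin n → S) × Ω => h p.1 (Y p.2) * ξ p.1 (Y p.2))
              (((refMeasure μ n).restrict A).prod P) →
            ∫ ω, innovation μ ξ h A (Z ω) (Y ω) ∂P = 0) ↔
          ∀ᵐ u ∂(refMeasure μ n), (fun ω => ξ u (Y ω)) =ᵐ[P]
            P[fun ω => atMarkOne (lam n) u (Xb ω) |
              MeasurableSpace.comap Y inferInstance]))) := by
  obtain rfl : Z = fun ω => (Xb ω).retained := funext hZ
  obtain rfl : Y = fun ω => (Xb ω).unretained := funext fun ω =>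
    (hY ω).trans (hXb.remove_retained_eq ω)
  have hZm : Measurable fun ω => (Xb ω).retained :=
    Config.measurable_retained.comp hXb.measurable_marked
  have hYm : Measurable fun ω => (Xb ω).unretained :=
    Config.measurable_unretained.comp hXb.measurable_marked
  -- the discarded points are disjoint from the retained ones
  have hrem : ∀ ω, ∀ u ∈ (Xb ω).retained.tuples n,
      (Xb ω).unretained.remove (Set.range u) = (Xb ω).unretained := by
    intro ω u hu
    rw [← hXb.remove_retained_eq ω]
    exact Config.remove_remove_range _ _ hu
  refine ⟨fun ξ ρ hξ hρ => ⟨fun h A hh hA => ⟨fun ω => rfl, ?_, ?_⟩, ?_⟩,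
    fun ξ lam hξ hlam => ?_⟩
  · exact integral_univariateInnovation hZm hρ hh hA
  · intro hρk h1 _
    obtain ⟨hmem, hvar⟩ := variance_univariateInnovation (ξ := ξ) hZm hρk hh hA h1
    refine ⟨hmem, hvar, fun hperm => ?_⟩
    rw [hvar, hperm.symmetrize_eq]
  · exact forall_integral_univariateInnovation_eq_zero_iff hZm hξ hρ
  have hC := hlam.campbellFormula hXb.measurable_marked
  have hmean : ∀ (h : (Fin n → S) → Config S → ℝ) (A : Set (Fin n → S)),
      Measurable (Function.uncurry h) → MeasurableSet A → _ → _ → _ :=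
    fun h A hh hA => CampbellFormula.integral_innovation (ξ := ξ) hZm hYm hC hh hA
  have hinn : ∀ (h : (Fin n → S) → Config S → ℝ) (A : Set (Fin n → S)) ω,
      innovation μ ξ h A (Xb ω).retained (Xb ω).unretained = _ :=
    fun h A ω => innovation_eq μ ξ h A (hrem ω)
  refine ⟨fun h A hh hA => ⟨?_, ?_⟩, fun hL2 => ?_⟩
  · simp_rw [hinn]
    exact hmean h A hh hA
  · intro hlamk h1 h2
    have h1' : ∫⁻ ω, (∑' x : (Xb ω).retained.tuples n,
        ‖A.indicator (fun v => h v (Xb ω).unretained) x‖ₑ) ^ 2 ∂P < ∞ := by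
      refine lt_of_eq_of_lt (lintegral_congr fun ω => ?_) h1
      congr 1
      simp only [enorm_indicator_eq_indicator_enorm]
      rw [← tsum_inter_eq_tsum_indicator _ A fun v => ‖h v (Xb ω).unretained‖ₑ]
      exact tsum_congr fun x => by rw [hrem ω x x.2.1]
    have key := CampbellFormula.integral_innovation_sq hZm hYm
      (w := fun k u ω => lam k (markOne u) (Xb ω))
      (fun k hk => (hlamk k hk).campbellFormula hXb.measurable_marked) hh hξ hA h1' h2
    simp_rw [hinn]
    refine ⟨key.1, key.2, fun hperm => ?_⟩
    rw [key.2]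
    simp_rw [(hperm _).symmetrize_eq]
    rfl
  · have key := forall_integral_mul_sub_eq_zero_iff (ν := refMeasure μ n) (P := P) hYm
      Config.exists_countable_piSystem (w := fun u ω => lam n (markOne u) (Xb ω)) hC.1 hξ
      (by filter_upwards [hL2] with u hu using hu.integrable one_le_two)
    refine Iff.trans ?_ key
    simp_rw [hinn]
    constructor
    · intro H h A hh hA hm h1 h2
      rw [← (hmean h A hh hA h1 h2).2]
      exact H h A hh hA hm h1 h2
    · intro H h A hh hA hm h1 h2
      rw [(hmean h A hh hA h1 h2).2]
      exact H h A hh hA hm h1 h2
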